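/- Let $n\ge 1$, let $G=GL(n,\mathbb C)$ with standard basis $e_1,\dots,e_n$ of $\mathbb C^n$, let $K=GL(n-1,\mathbb C)$ be embedded in $G$ as the matrices $\mathrm{diag}(A,1)$, let $B_n\subset G$ be the upper triangular matrices and $B_{n-1}=K\cap B_n$. Let $\mathcal B_n$ be the variety of complete flags in $\mathbb C^n$; $(v_1\subset\dots\subset v_n)$ denotes the flag with $V_k=\mathrm{span}\{v_1,\dots,v_k\}$, and $\mathcal F_+=(e_1\subset\dots\subset e_n)$. For $k<n$ put $\hat e_k=e_k+e_n$ (a hat vector of index $k$). A flag $(v_1\subset\dots\subset v_n)$ is in standard form, with indices $\ell_1,\dots,\ell_n$, if each $v_m$ is $e_{\ell_m}$ or the hat vector $\hat e_{\ell_m}$, some $v_m$ is $e_n$, no hat vector occurs after $e_n$, and $\ell_m>\ell_k$ whenever $m<k$ and $v_m=\hat e_{\ell_m}$, $v_k=\hat e_{\ell_k}$. For $1\le i<j\le n$ let $Q_{i,j}$ be the $K$-orbit of $(e_1\subset\dots\subset e_{i-1}\subset \hat e_{j-1}\subset e_i\subset\dots\subset e_{j-2}\subset e_n\subset e_j\subset\dots\subset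 e_{n-1})$ ($\hat e_{j-1}$ at position $i$, $e_n$ at position $j$), and let $Q_i$ be the $K$-orbit of $(e_1\subset\dots\subset e_{i-1}\subset e_n\subset e_i\subset\dots\subset e_{n-1})$ ($e_n$ at position $i$). For the simple root $\alpha=\alpha_a=\epsilon_a-\epsilon_{a+1}$, $1\le a\le n-1$, let $\pi_\alpha$ be the projection of $\mathcal B_n$ that forgets the subspace of dimension $a$, and let $s_\alpha(\mathcal F_+)$ be $\mathcal F_+$ with $e_a$ and $e_{a+1}$ exchanged. For a $B_{n-1}$-orbit $Q$, $m(s_\alpha)*Q$ is the unique $B_{n-1}$-orbit that is (Zariski) open and dense in $\pi_\alpha^{-1}(\pi_\alpha(Q))$. The root $\alpha$ is complex stable for $Q$ if $m(s_\alpha)*Q\ne Q$ and $\pi_\alpha^{-1}(\pi_\alpha(Q))$ is the union of two distinct orbits $Q=B_{n-1}\cdot v\mathcal F_+$ and $B_{n-1}\cdot v\,s_\alpha(\mathcal F_+)$ for some $v\in G$; it is non-compact for $Q$ if $m(s_\alpha)*Q\neq Q$ and $\pi_\alpha^{-1}(\pi_\alpha(Q))$ consists of exactly three $B_{n-1}$-orbits.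 If $\mathcal F$ is in standard form and $Q=B_{n-1}\cdot\mathcal F$, then $m(s_\alpha)*\mathcal F$ denotes the unique flag in standard form contained in $m(s_\alpha)*Q$. **Proposition.** Let $\mathcal F=(v_1\subset\dots\subset v_n)$ be a flag in standard form with indices $\ell_1,\dots,\ell_n$, and let $Q=B_{n-1}\cdot\mathcal F$. *Case I.* Suppose $Q\subset Q_{i,j}$ with $1\le i<j\le n$. Then $\mathcal F$ has the form $$\mathcal F=(e_{\ell_1}\subset\dots\subset e_{\ell_{i-1}}\subset\hat e_{\ell_i}\subset v_{i+1}\subset\dots\subset v_{j-1}\subset e_n\subset e_{\ell_{j+1}}\subset\dots\subset e_{\ell_n}),$$ with $\hat e_{\ell_i}$ at position $i$, $e_n$ at position $j$, $\ell_m<n$ for all $m\neq j$, and $v_m\in\{e_{\ell_m},\hat e_{\ell_m}\}$ for $i<m<j$. (1) Suppose $i\ge 2$. (a) If $\ell_{i-1}<\ell_i$, then $\alpha_{i-1}$ is complex stable for $Q$, and $m(s_{\alpha_{i-1}})*\mathcal F$ is obtained from $\mathcal F$ by replacing the vectors at positions $i-1,i$ by $\hat e_{\ell_i},\,e_{\ell_{i-1}}$.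 (b) If $\ell_{i-1}>\ell_i$, then $\alpha_{i-1}$ is non-compact for $Q$, and $m(s_{\alpha_{i-1}})*\mathcal F$ is obtained from $\mathcal F$ by replacing the vectors at positions $i-1,i$ by $\hat e_{\ell_{i-1}},\,\hat e_{\ell_i}$. (2) Suppose $j\le n-1$, and let $k=\min(\{\ell_i\}\cup\{t : v_m=\hat e_t \text{ for some } i<m<j\})$. (a) If $\ell_{j+1}>k$, then $\alpha_j$ is complex stable for $Q$, and $m(s_{\alpha_j})*\mathcal F$ is obtained from $\mathcal F$ by replacing the vectors at positions $j,j+1$ by $e_{\ell_{j+1}},\,e_n$. (b) If $\ell_{j+1}<k$, then $\alpha_j$ is non-compact for $Q$, and $m(s_{\alpha_j})*\mathcal F$ is obtained from $\mathcal F$ by replacing the vectors at positions $j,j+1$ by $\hat e_{\ell_{j+1}},\,e_n$. *Case II.* Suppose $Q\subset Q_i$ with $1\le i\le n$. Then $\mathcal F=(e_{\ell_1}\subset\dots\subset e_{\ell_{i-1}}\subset e_n\subset e_{\ell_{i+1}}\subset\dots\subset e_{\ell_n})$ with $e_n$ at position $i$ and $\ell_m<n$ for $m\ne i$. If $i\ge2$,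 then $\alpha_{i-1}$ is non-compact for $Q$, and $m(s_{\alpha_{i-1}})*\mathcal F$ is obtained from $\mathcal F$ by replacing the vectors at positions $i-1,i$ by $\hat e_{\ell_{i-1}},\,e_n$. If $i\le n-1$, then $\alpha_i$ is non-compact for $Q$, and $m(s_{\alpha_i})*\mathcal F$ is obtained from $\mathcal F$ by replacing the vectors at positions $i,i+1$ by $\hat e_{\ell_{i+1}},\,e_n$. -/

import Mathlib

/-! Throughout, the rank parameter `r` corresponds to `n = r + 1`, so that `G = GL(n)`,
`K = GL(n - 1)` and `e_n = e (Fin.last r)`.  Positions and indices `1, …, n` are the elements of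
`Fin (r + 1)`, in the same order; the simple root `α_{a+1} = ε_{a+1} - ε_{a+2}` is `a : Fin r`:
it moves the subspace of dimension `a + 1`, and it exchanges the neighbouring positions
`a.castSucc` and `a.succ`. -/

namespace FlagOrbits

/-- The vector space `ℂⁿ`, `n = r + 1`. -/
abbrev Vec (r : ℕ) : Type := Fin (r + 1) → ℂ

/-- The group `G = GL(n)`. -/
abbrev GLn (r : ℕ) : Type := Matrix.GeneralLinearGroup (Fin (r + 1)) ℂ

/-- The standard basis vector `e_k`. -/
def e {r : ℕ} (k : Fin (r + 1)) : Vec r := Pi.single k 1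

/-- The vector `ê_k = e_k + e_n` (a hat vector when `k < n`). -/
def eHat {r : ℕ} (k : Fin (r + 1)) : Vec r := e k + e (Fin.last r)

/-- `w` is the hat vector of index `k < n`. -/
def IsHat {r : ℕ} (w : Vec r) (k : Fin (r + 1)) : Prop := k ≠ Fin.last r ∧ w = eHat k

/-! ### The flag variety -/

/-- Complete flags `0 = V_0 ⊂ V_1 ⊂ ⋯ ⊂ V_n = ℂⁿ`. -/
@[ext]
structure CompleteFlag (r : ℕ) where
  V : Fin (r + 2) → Submodule ℂ (Vec r)
  mono : Monotone V
  finrank_eq : ∀ k, Module.finrank ℂ (V k) = k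

/-- `F = (v_1 ⊂ v_2 ⊂ ⋯ ⊂ v_n)`: the `k`-th subspace of `F` is spanned by the first `k` of the
vectors. -/
def CompleteFlag.SpannedBy {r : ℕ} (F : CompleteFlag r) (v : Fin (r + 1) → Vec r) : Prop :=
  ∀ k, F.V k = Submodule.span ℂ (v '' {m | m.castSucc < k})

theorem finrank_basis_flag {r : ℕ} (b : Module.Basis (Fin (r + 1)) ℂ (Vec r))
    (k : Fin (r + 2)) : Module.finrank ℂ (b.flag k) = k := by
  have hli : LinearIndepOn ℂ b {i : Fin (r + 1) | i.castSucc < k} :=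
    b.linearIndependent.linearIndepOn _
  have h := finrank_span_eq_card hli
  have hr : Set.range (fun i : {i : Fin (r + 1) | i.castSucc < k} => b i)
      = b '' {i | i.castSucc < k} := by
    rw [Set.image_eq_range]
  rw [Module.Basis.flag, ← hr]
  refine h.trans ?_
  have hk : (k : ℕ) ≤ r + 1 := Nat.lt_succ_iff.mp k.isLt
  rw [Fintype.card_subtype]
  have : (Finset.univ.filter fun i : Fin (r + 1) => i ∈ {i : Fin (r + 1) | i.castSucc < k})
      = Finset.univ.filter fun i : Fin (r + 1) => (i : ℕ) < k := by
    ext i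
    simp [Fin.lt_def]
  rw [this, Fin.card_filter_val_lt]
  omega

/-- The flag of a basis of `ℂⁿ`. -/
def flagOfBasis {r : ℕ} (b : Module.Basis (Fin (r + 1)) ℂ (Vec r)) : CompleteFlag r where
  V := b.flag
  mono := b.flag_mono
  finrank_eq := finrank_basis_flag b

/-- The flag `w(F_+) = (e_{w(1)} ⊂ ⋯ ⊂ e_{w(n)})` for an element `w` of the Weyl group. -/
noncomputable def weylFlag {r : ℕ} (w : Equiv.Perm (Fin (r + 1))) : CompleteFlag r :=
  flagOfBasis ((Pi.basisFun ℂ (Fin (r + 1))).reindex w.symm)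

/-- The standard flag `F_+ = (e_1 ⊂ ⋯ ⊂ e_n)`. -/
noncomputable def stdFlag (r : ℕ) : CompleteFlag r := weylFlag 1

/-- `GL(n)` acts on complete flags. -/
noncomputable instance (r : ℕ) : MulAction (GLn r) (CompleteFlag r) where
  smul g F :=
    { V := fun k => (F.V k).map (Matrix.GeneralLinearGroup.toLin g).toLinearEquiv.toLinearMap
      mono := fun _ _ h => Submodule.map_mono (F.mono h)
      finrank_eq := fun k => by rw [LinearEquiv.finrank_map_eq, F.finrank_eq] }
  one_smul F := by
    refine CompleteFlag.ext (funext fun k => ?_)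
    change (F.V k).map (Matrix.GeneralLinearGroup.toLin (1 : GLn r)).toLinearEquiv.toLinearMap = _
    rw [map_one]
    exact Submodule.map_id _
  mul_smul g h F := by
    refine CompleteFlag.ext (funext fun k => ?_)
    change (F.V k).map (Matrix.GeneralLinearGroup.toLin (g * h)).toLinearEquiv.toLinearMap
      = ((F.V k).map (Matrix.GeneralLinearGroup.toLin h).toLinearEquiv.toLinearMap).map
          (Matrix.GeneralLinearGroup.toLin g).toLinearEquiv.toLinearMap
    rw [map_mul, ← Submodule.map_comp]
    rfl

/-- The Zariski topology on the group `GL(n)`, as a subspace of the affine space of matrices. -/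
@[reducible] noncomputable def zariskiGL (r : ℕ) : TopologicalSpace (GLn r) :=
  TopologicalSpace.induced
    (fun g => (MvPolynomial.pointToPoint (k := ℂ) fun p : Fin (r + 1) × Fin (r + 1) =>
      (g : Matrix (Fin (r + 1)) (Fin (r + 1)) ℂ) p.1 p.2))
    PrimeSpectrum.zariskiTopology

/-- The Zariski topology on the flag variety `G / B_n`: the quotient topology of the Zariski
topology of `G` under `g ↦ g • F_+`. -/
noncomputable instance zariskiFlag (r : ℕ) : TopologicalSpace (CompleteFlag r) :=
  TopologicalSpace.coinduced (fun g : GLn r => g • stdFlag r) (zariskiGL r)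

/-! ### The subgroups and their orbits -/

/-- The subgroup `K = GL(n - 1)` of `GL(n)`, embedded as the matrices `diag(A, 1)`: those whose
last column is `e_n` and whose last row is `e_nᵀ`. -/
def K (r : ℕ) : Subgroup (GLn r) where
  carrier := {g | (g : Matrix _ _ ℂ).mulVec (e (Fin.last r)) = e (Fin.last r) ∧
    (g : Matrix _ _ ℂ).vecMul (e (Fin.last r)) = e (Fin.last r)}
  one_mem' := by simp
  mul_mem' := by
    rintro g h ⟨g₁, g₂⟩ ⟨h₁, h₂⟩
    constructor
    · rw [Units.val_mul, ← Matrix.mulVec_mulVec, h₁, g₁]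
    · rw [Units.val_mul, ← Matrix.vecMul_vecMul, g₂, h₂]
  inv_mem' := by
    rintro g ⟨g₁, g₂⟩
    constructor
    · conv_lhs => rw [← g₁]
      rw [Matrix.mulVec_mulVec, ← Units.val_mul, inv_mul_cancel, Units.val_one, Matrix.one_mulVec]
    · conv_lhs => rw [← g₂]
      rw [Matrix.vecMul_vecMul, ← Units.val_mul, mul_inv_cancel, Units.val_one, Matrix.vecMul_one]

/-- The subgroup `B_n` of upper triangular matrices in `GL(n)`. -/
def borel (r : ℕ) : Subgroup (GLn r) where
  carrier := {g | (g : Matrix (Fin (r + 1)) (Fin (r + 1)) ℂ).BlockTriangular id}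
  one_mem' := Matrix.blockTriangular_one
  mul_mem' := fun hg hh => Matrix.BlockTriangular.mul hg hh
  inv_mem' := by
    intro g hg
    have : Invertible (g : Matrix (Fin (r + 1)) (Fin (r + 1)) ℂ) := g.invertible
    have h := Matrix.blockTriangular_inv_of_blockTriangular hg
    rwa [← Matrix.coe_units_inv] at h

/-- `B_{n-1} = K ∩ B_n`. -/
def Bsub (r : ℕ) : Subgroup (GLn r) := K r ⊓ borel r

/-- The orbit `M · F`. -/
def orb {r : ℕ} (M : Subgroup (GLn r)) (F : CompleteFlag r) : Set (CompleteFlag r) :=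
  MulAction.orbit M F

/-- `Q` is an `M`-orbit on the flag variety. -/
def IsOrb {r : ℕ} (M : Subgroup (GLn r)) (Q : Set (CompleteFlag r)) : Prop :=
  ∃ F, Q = orb M F

/-- The vectors of the reference flag `F_{i,j}`, `i ≤ j`:
`(e_1 ⊂ ⋯ ⊂ e_{i-1} ⊂ ê_{j-1} ⊂ e_i ⊂ ⋯ ⊂ e_{j-2} ⊂ e_n ⊂ e_j ⊂ ⋯ ⊂ e_{n-1})` for `i < j`, with
`ê_{j-1}` at position `i` and `e_n` at position `j`; and
`(e_1 ⊂ ⋯ ⊂ e_{i-1} ⊂ e_n ⊂ e_i ⊂ ⋯ ⊂ e_{n-1})` for `i = j`, with `e_n` at position `i`.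
Here `prev` shifts an index down by one. -/
def refVec {r : ℕ} (i j m : Fin (r + 1)) : Vec r :=
  let prev : Fin (r + 1) → Fin (r + 1) := fun x => ⟨(x : ℕ) - 1, by omega⟩
  if m < i then e m
  else if m = j then e (Fin.last r)
  else if m = i then eHat (prev j)
  else e (prev m)

/-- The `K`-orbit `Q_{i,j}` through the flag `F_{i,j}`; `Q_{i,i}` is the closed orbit `Q_i`. -/
def QK {r : ℕ} (i j : Fin (r + 1)) : Set (CompleteFlag r) :=
  {F | ∃ F₀ : CompleteFlag r, F₀.SpannedBy (refVec i j) ∧ F ∈ orb (K r) F₀}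

/-! ### The monoid action and the types of roots -/

/-- The projection `π_α` to the partial flags of type `α`, for `α = α_{a+1}`: it forgets the
subspace of dimension `a + 1`. -/
def piRoot {r : ℕ} (a : Fin r) (F : CompleteFlag r) :
    {k : Fin (r + 2) // k ≠ a.succ.castSucc} → Submodule ℂ (Vec r) :=
  fun k => F.V k

/-- The set `π_α⁻¹(π_α(Q))`. -/
def sat {r : ℕ} (a : Fin r) (Q : Set (CompleteFlag r)) : Set (CompleteFlag r) :=
  piRoot a ⁻¹' (piRoot a '' Q)

/-- `m(s_α) * Q = Q'`: the set `Q'` is an `M`-orbit that is open and dense in `π_α⁻¹(π_α(Q))`.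
Two dense open subsets of a nonempty space meet, so there is at most one such orbit. -/
def MonoidAct {r : ℕ} (M : Subgroup (GLn r)) (a : Fin r) (Q Q' : Set (CompleteFlag r)) : Prop :=
  IsOrb M Q' ∧ Q' ⊆ sat a Q ∧ (∃ U, IsOpen U ∧ Q' = sat a Q ∩ U) ∧ sat a Q ⊆ closure Q'

/-- `m(s_α) * Q` exists and is different from `Q`. -/
def Moves {r : ℕ} (M : Subgroup (GLn r)) (a : Fin r) (Q : Set (CompleteFlag r)) : Prop :=
  ∃ Q', MonoidAct M a Q Q' ∧ Q' ≠ Q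

/-- `α` is complex for `Q`: the set `π_α⁻¹(π_α(Q))` is the union of the two orbits
`Q = M · v F_+` and `M · v s_α(F_+)`. -/
def IsComplex {r : ℕ} (M : Subgroup (GLn r)) (a : Fin r) (Q : Set (CompleteFlag r)) : Prop :=
  ∃ v : GLn r, Q = orb M (v • stdFlag r) ∧
    orb M (v • weylFlag (Equiv.swap a.castSucc a.succ)) ≠ Q ∧
    sat a Q = Q ∪ orb M (v • weylFlag (Equiv.swap a.castSucc a.succ))

/-- `α` is complex stable for `Q`. -/
def IsComplexStable {r : ℕ} (M : Subgroup (GLn r)) (a : Fin r) (Q : Set (CompleteFlag r)) :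
    Prop :=
  IsComplex M a Q ∧ Moves M a Q

/-- `α` is non-compact (imaginary) for `Q`: the set `π_α⁻¹(π_α(Q))` consists of exactly three
`M`-orbits, and `m(s_α) * Q ≠ Q`. -/
def IsNoncompact {r : ℕ} (M : Subgroup (GLn r)) (a : Fin r) (Q : Set (CompleteFlag r)) : Prop :=
  {O : Set (CompleteFlag r) | IsOrb M O ∧ O ⊆ sat a Q}.ncard = 3 ∧ Moves M a Q

/-! ### Standard form -/

/-- The sequence `v_1, …, v_n` with indices `ℓ_1, …, ℓ_n` is in standard form: each `v_m` is
`e_{ℓ_m}` or the hat vector of index `ℓ_m`, some `v_m` is `e_n`, no hat vector occurs after `e_n`,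
and the indices of the hat vectors decrease. -/
structure IsStandardSeq {r : ℕ} (v : Fin (r + 1) → Vec r) (ℓ : Fin (r + 1) → Fin (r + 1)) :
    Prop where
  vec : ∀ m, v m = e (ℓ m) ∨ IsHat (v m) (ℓ m)
  exists_last : ∃ m, v m = e (Fin.last r)
  after_last : ∀ m k, v m = e (Fin.last r) → m < k → v k = e (ℓ k)
  hat_anti : ∀ m k, m < k → IsHat (v m) (ℓ m) → IsHat (v k) (ℓ k) → ℓ k < ℓ m

/-- A flag in standard form. -/
def CompleteFlag.IsStandard {r : ℕ} (F : CompleteFlag r) : Prop :=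
  ∃ v ℓ, IsStandardSeq v ℓ ∧ F.SpannedBy v

/-- `m(s_α) * F = (w_1 ⊂ ⋯ ⊂ w_n)`, where `m(s_α) * F` is the unique flag in standard form
contained in the `B_{n-1}`-orbit `m(s_α) * (B_{n-1} · F)`: the sequence `w` is in standard form,
and the flag that it spans is the one and only standard flag in that orbit. -/
def StdMonoidAct {r : ℕ} (a : Fin r) (F : CompleteFlag r) (w : Fin (r + 1) → Vec r) : Prop :=
  (∃ ℓ, IsStandardSeq w ℓ) ∧
  ∃ F' : CompleteFlag r, F'.SpannedBy w ∧
    ∃ Q', MonoidAct (Bsub r) a (orb (Bsub r) F) Q' ∧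
      ∀ F'' : CompleteFlag r, (F''.IsStandard ∧ F'' ∈ Q') ↔ F'' = F'

/-- The sequence `v` with its vectors at the positions `a.castSucc`, `a.succ` replaced by `x`
and `y`. -/
def replaceAt {r : ℕ} (v : Fin (r + 1) → Vec r) (a : Fin r) (x y : Vec r) :
    Fin (r + 1) → Vec r :=
  Function.update (Function.update v a.castSucc x) a.succ y

end FlagOrbits

open FlagOrbits

namespace FlagOrbits

open scoped Topology

variable {r : ℕ}

/-! ### Flags spanned by sequences of vectors -/

/-! Fix `a`, and write `x`, `y` for the vectors of `F` at the positions `a.castSucc`, `a.succ`. The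
fibre of `π_α` through `F` is a projective line: its points replace `(x, y)` by `(x + t y, y)`, with
`t = 0` giving `F`, or by the flip `(y, x)` at infinity (`spannedBy_of_piRoot_eq`). Every orbit in
the saturation meets this line, so it suffices to see which of its points `B_{n-1}` identifies.

An elementary matrix `1 + z e_pᵀ` with `p` the index of `x` or of `y` fixes all other `v_m`, because
their `p`-th coordinate vanishes (`mem_orb_of_elementary`). In each of the five configurations of
neighbours, a suitable `z` carries all points with `t ≠ 0` into one orbit: that of the flip in the
complex cases, that of a third flag in the non-compact ones.

The remaining orbits are separated by `B_{n-1}`-stable subspaces `Z`, through the condition that the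
subspace of dimension `a + 1` is not inside that of dimension `a` plus `Z` (`Escapes`). It is
invariant on orbits and, by semicontinuity of rank, open on the saturation, so it also exhibits the
big orbit as open. Density holds because a Zariski closed set containing a punctured affine line in
`GL(n)` contains its missing point whenever that point is in the group. These arguments are packaged
in `isComplexStable_and_monoidAct` and `isNoncompact_and_monoidAct`.

The sequence named in the statement must be the only standard form in its orbit. By induction on the
position (`eq_of_smul_eq`), an orbit remembers where `e_n` enters, the indices (leading coordinates
below `n` are only rescaled), and which vectors are hats. The last point uses the form `x_n - ∑ x_t`
over the hat indices and the fact that these indices decrease. -/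

theorem e_apply (k l : Fin (r + 1)) : (e k : Vec r) l = if l = k then 1 else 0 := by
  simp [e, Pi.single_apply]

theorem CompleteFlag.eq_of_le {F G : CompleteFlag r} (h : ∀ k, F.V k ≤ G.V k) : F = G :=
  CompleteFlag.ext (funext fun k => Submodule.eq_of_le_of_finrank_eq (h k)
    ((F.finrank_eq k).trans (G.finrank_eq k).symm))

namespace CompleteFlag.SpannedBy

variable {F G : CompleteFlag r} {v : Fin (r + 1) → Vec r}

theorem mem (h : F.SpannedBy v) {m : Fin (r + 1)} {k : Fin (r + 2)} (hk : m.castSucc < k) :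
    v m ∈ F.V k := by
  rw [h k]
  exact Submodule.subset_span ⟨m, hk, rfl⟩

theorem mem_succ (h : F.SpannedBy v) (m : Fin (r + 1)) : v m ∈ F.V m.succ :=
  h.mem Fin.castSucc_lt_succ

theorem le_iff (h : F.SpannedBy v) {k : Fin (r + 2)} {W : Submodule ℂ (Vec r)} :
    F.V k ≤ W ↔ ∀ m : Fin (r + 1), m.castSucc < k → v m ∈ W := by
  rw [h k, Submodule.span_le, Set.image_subset_iff]
  exact Iff.rfl

theorem eq_of_mem (h : F.SpannedBy v) (hG : ∀ m : Fin (r + 1), v m ∈ G.V m.succ) : F = G :=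
  eq_of_le fun _ => h.le_iff.2 fun m hm => G.mono (Fin.castSucc_lt_iff_succ_le.1 hm) (hG m)

theorem unique (h : F.SpannedBy v) (hG : G.SpannedBy v) : F = G :=
  h.eq_of_mem hG.mem_succ

theorem linearIndependent (h : F.SpannedBy v) : LinearIndependent ℂ v := by
  rw [linearIndependent_iff_card_eq_finrank_span]
  have h1 := F.finrank_eq (Fin.last _)
  have h2 : {m : Fin (r + 1) | m.castSucc < Fin.last (r + 1)} = Set.univ := by
    ext m
    simp [Fin.castSucc_lt_last]
  rw [h, h2, Set.image_univ] at h1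
  simpa [Set.finrank] using h1.symm

theorem notMem (h : F.SpannedBy v) (m : Fin (r + 1)) : v m ∉ F.V m.castSucc := by
  rw [h]
  exact h.linearIndependent.notMem_span_image (by simp)

/-- The matrix whose columns are the vectors spanning a flag. -/
theorem exists_mulVec_eq (h : F.SpannedBy v) : ∃ g : GLn r, ∀ m, g.1.mulVec (e m) = v m := by
  have h1 : IsUnit (Matrix.of v).transpose := by
    rw [← Matrix.linearIndependent_cols_iff_isUnit]
    exact h.linearIndependent
  obtain ⟨g, hg⟩ := h1
  refine ⟨g, fun m => ?_⟩
  rw [hg, e, Matrix.mulVec_single_one]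
  rfl

end CompleteFlag.SpannedBy

theorem smul_V (g : GLn r) (F : CompleteFlag r) (k : Fin (r + 2)) :
    (g • F).V k = (F.V k).map (Matrix.toLin' g.1) := rfl

theorem mulVec_mem_smul_V (g : GLn r) {F : CompleteFlag r} {k : Fin (r + 2)} {x : Vec r}
    (hx : x ∈ F.V k) : g.1.mulVec x ∈ (g • F).V k :=
  ⟨x, hx, Matrix.toLin'_apply _ _⟩

theorem CompleteFlag.SpannedBy.smul {F : CompleteFlag r} {v : Fin (r + 1) → Vec r}
    (h : F.SpannedBy v) (g : GLn r) : (g • F).SpannedBy fun m => g.1.mulVec (v m) := by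
  intro k
  rw [smul_V, h k, Submodule.map_span, Set.image_image]
  rfl

theorem weylFlag_spannedBy (w : Equiv.Perm (Fin (r + 1))) :
    (weylFlag w).SpannedBy fun m => e (w m) := by
  intro k
  change Module.Basis.flag _ k = _
  rw [Module.Basis.flag]
  congr 2
  ext1 m
  simp [e]

theorem stdFlag_spannedBy : (stdFlag r).SpannedBy e := weylFlag_spannedBy 1

theorem CompleteFlag.SpannedBy.eq_smul_stdFlag {F : CompleteFlag r} {v : Fin (r + 1) → Vec r}
    (h : F.SpannedBy v) {g : GLn r} (hg : ∀ m, g.1.mulVec (e m) = v m) : F = g • stdFlag r := by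
  have := stdFlag_spannedBy.smul g
  simp only [hg] at this
  exact h.unique this

theorem smul_eq_of_mem {F G : CompleteFlag r} {v : Fin (r + 1) → Vec r} (h : F.SpannedBy v)
    {g : GLn r} (hg : ∀ m : Fin (r + 1), g.1.mulVec (v m) ∈ G.V m.succ) : g • F = G :=
  (h.smul g).eq_of_mem hg

/-- The matrix `1 + z e_pᵀ`, where `z ∈ span {e_1, …, e_p}` and `p < n`, lies in `B_{n-1}` if it
is invertible. -/
theorem exists_mem_Bsub (p : Fin (r + 1)) (hp : p ≠ Fin.last r) (z : Vec r)
    (hz : ∀ l, p < l → z l = 0) (hzp : 1 + z p ≠ 0) :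
    ∃ b ∈ Bsub r, ∀ x, b.1.mulVec x = x + x p • z := by
  have hp' : p < Fin.last r := Fin.lt_last_iff_ne_last.2 hp
  set A : Matrix (Fin (r + 1)) (Fin (r + 1)) ℂ := 1 + Matrix.vecMulVec z (e p) with hA
  have hmul : ∀ x, A.mulVec x = x + x p • z := by
    intro x
    rw [hA, Matrix.add_mulVec, Matrix.one_mulVec, Matrix.vecMulVec_mulVec]
    simp [e]
  have htri : A.BlockTriangular id := by
    intro i j hij
    simp only [id] at hij
    rw [hA, Matrix.add_apply, Matrix.one_apply_ne hij.ne', Matrix.vecMulVec_apply, e_apply]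
    split_ifs with h
    · rw [hz i (h ▸ hij)]
      simp
    · simp
  have hdet : A.det ≠ 0 := by
    rw [Matrix.det_of_isUpperTriangular htri, Finset.prod_ne_zero_iff]
    intro i _
    rw [hA, Matrix.add_apply, Matrix.one_apply_eq, Matrix.vecMulVec_apply, e_apply]
    split_ifs with h
    · simpa [h] using hzp
    · simp
  refine ⟨Matrix.GeneralLinearGroup.mkOfDetNeZero A hdet, ⟨⟨?_, ?_⟩, htri⟩, hmul⟩
  · refine (hmul _).trans ?_
    rw [e_apply, if_neg hp, zero_smul, add_zero]
  · change A.vecMul _ = _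
    rw [hA, Matrix.vecMul_add, Matrix.vecMul_one, Matrix.vecMul_vecMulVec]
    have : (e (Fin.last r) : Vec r) ⬝ᵥ z = 0 := by
      simp [e, hz _ hp']
    rw [this]
    simp

/-! ### The Zariski topology -/

theorem mem_zeroLocus_pointToPoint {σ : Type*} (s : Set (MvPolynomial σ ℂ)) (x : σ → ℂ) :
    MvPolynomial.pointToPoint (k := ℂ) x ∈ PrimeSpectrum.zeroLocus s ↔
      ∀ f ∈ s, MvPolynomial.eval x f = 0 := by
  rw [PrimeSpectrum.mem_zeroLocus]
  change s ⊆ (MvPolynomial.vanishingIdeal ℂ {x} : Set _) ↔ _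
  simp only [Set.subset_def, SetLike.mem_coe, MvPolynomial.mem_vanishingIdeal_iff,
    Set.mem_singleton_iff, forall_eq]
  rfl

theorem isOpen_eval_ne_zero (f : MvPolynomial (Fin (r + 1) × Fin (r + 1)) ℂ) :
    IsOpen[zariskiGL r] {g : GLn r | MvPolynomial.eval (fun p => g.1 p.1 p.2) f ≠ 0} := by
  refine ⟨(PrimeSpectrum.zeroLocus {f})ᶜ, (PrimeSpectrum.isClosed_zeroLocus _).isOpen_compl, ?_⟩
  ext g
  simp only [Set.mem_preimage, Set.mem_compl_iff, mem_zeroLocus_pointToPoint,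
    Set.mem_singleton_iff, forall_eq]
  rfl

/-- A Zariski closed set that contains a punctured line contains the line. -/
theorem mem_of_isClosed_zariskiGL {C : Set (GLn r)} (hC : IsClosed[zariskiGL r] C)
    (γ : ℂ → GLn r) (X Y : Matrix (Fin (r + 1)) (Fin (r + 1)) ℂ) (hγ : ∀ t, (γ t).1 = X + t • Y)
    (h : ∀ t, t ≠ 0 → γ t ∈ C) : γ 0 ∈ C := by
  obtain ⟨Z, hZ, rfl⟩ := (@isClosed_induced_iff _ _ (_) _ _).1 hC
  obtain ⟨s, rfl⟩ := (PrimeSpectrum.isClosed_iff_zeroLocus _).1 hZ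
  simp only [Set.mem_preimage, mem_zeroLocus_pointToPoint] at h ⊢
  intro f hf
  -- The restriction of `f` to the line `X + t Y`. It has infinitely many roots, hence is zero and
  -- also vanishes at `t = 0`.
  let q : Polynomial ℂ := MvPolynomial.aeval
    (fun p : Fin (r + 1) × Fin (r + 1) =>
      Polynomial.C (X p.1 p.2) + Polynomial.C (Y p.1 p.2) * Polynomial.X) f
  have hq : ∀ t, q.eval t = MvPolynomial.eval (fun p => (γ t).1 p.1 p.2) f := by
    intro t
    have : q.eval t = ((Polynomial.aeval t).comp (MvPolynomial.aeval
        (fun p : Fin (r + 1) × Fin (r + 1) =>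
          Polynomial.C (X p.1 p.2) + Polynomial.C (Y p.1 p.2) * Polynomial.X))) f := by
      simp [q]
    rw [this, MvPolynomial.comp_aeval, ← MvPolynomial.coe_aeval_eq_eval]
    simp [hγ, mul_comm t]
  have hq0 : q = 0 := by
    refine Polynomial.eq_zero_of_infinite_isRoot q ?_
    refine Set.Infinite.mono (s := {0}ᶜ) ?_ (Set.finite_singleton (0 : ℂ)).infinite_compl
    intro t ht
    exact (hq t).trans (h t ht f hf)
  rw [← hq, hq0, Polynomial.eval_zero]

/-- A subspace has dimension at least `d` iff it contains the columns of some matrix with a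
nonvanishing product of size `d`. -/
theorem le_finrank_iff_exists_det {d : ℕ} (W : Submodule ℂ (Vec r)) :
    d ≤ Module.finrank ℂ W ↔ ∃ (X : Fin d → Vec r) (A : Matrix (Fin d) (Fin (r + 1)) ℂ),
      (∀ i, X i ∈ W) ∧ (A * (Matrix.of X).transpose).det ≠ 0 := by
  constructor
  · intro h
    obtain ⟨f, hf⟩ := exists_linearIndependent_of_le_finrank h
    have hX : LinearIndependent ℂ fun i => (f i : Vec r) :=
      hf.map' W.subtype (Submodule.ker_subtype W)
    have hX' : LinearIndependent ℂ (Matrix.of fun i => (f i : Vec r)).transpose.col := hX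
    rw [← Matrix.mulVec_injective_iff] at hX'
    obtain ⟨g, hg⟩ := LinearMap.exists_leftInverse_of_injective
      (Matrix.toLin' (Matrix.of fun i => (f i : Vec r)).transpose) (LinearMap.ker_eq_bot.2 hX')
    refine ⟨fun i => f i, LinearMap.toMatrix' g, fun i => (f i).2, ?_⟩
    have hA := congrArg LinearMap.toMatrix' hg
    rw [LinearMap.toMatrix'_comp, LinearMap.toMatrix'_toLin', LinearMap.toMatrix'_id] at hA
    rw [hA]
    simp
  · rintro ⟨X, A, hX, hA⟩
    have hX' : LinearIndependent ℂ X := by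
      have : LinearIndependent ℂ (Matrix.of X).transpose.col := by
        rw [← Matrix.mulVec_injective_iff]
        intro x y hxy
        refine Matrix.mulVec_injective_of_isUnit
          ((Matrix.isUnit_iff_isUnit_det _).2 (isUnit_iff_ne_zero.2 hA)) ?_
        simp only [← Matrix.mulVec_mulVec]
        exact congrArg _ hxy
      exact this
    have : LinearIndependent ℂ fun i => (⟨X i, hX i⟩ : W) :=
      LinearIndependent.of_comp W.subtype hX'
    simpa using this.fintype_card_le_finrank

/-- Lower semicontinuity of rank. In the quotient topology it is enough to look at the preimage in
`GL(n)`, which is a union of loci where a determinant polynomial in the matrix entries does not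
vanish. -/
theorem isOpen_le_finrank_sup (k : Fin (r + 2)) (Z : Submodule ℂ (Vec r)) (d : ℕ) :
    IsOpen {F : CompleteFlag r | d ≤ Module.finrank ℂ ↥(F.V k ⊔ Z)} := by
  rw [isOpen_coinduced]
  have : (fun g : GLn r => g • stdFlag r) ⁻¹'
      {F : CompleteFlag r | d ≤ Module.finrank ℂ ↥(F.V k ⊔ Z)} =
      ⋃ (X : {X : Fin d → Vec r // ∀ i, X i ∈ (stdFlag r).V k}) (Y : {Y : Fin d → Vec r //
        ∀ i, Y i ∈ Z}) (A : Matrix (Fin d) (Fin (r + 1)) ℂ),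
        {g : GLn r | (A * (g.1 * (Matrix.of X.1).transpose +
          (Matrix.of Y.1).transpose)).det ≠ 0} := by
    ext g
    simp only [Set.mem_preimage, Set.mem_ofPred_eq, Set.mem_iUnion, le_finrank_iff_exists_det]
    constructor
    · rintro ⟨X, A, hX, hA⟩
      simp only [Submodule.mem_sup, smul_V, Submodule.mem_map] at hX
      choose _ hy z hz hX using hX
      choose y hy hy' using hy
      refine ⟨⟨y, hy⟩, ⟨z, hz⟩, A, ?_⟩
      convert hA using 4
      ext i j
      have := congrFun (hX j) i
      rw [← hy' j] at this
      exact this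
    · rintro ⟨⟨X, hX⟩, ⟨Y, hY⟩, A, hA⟩
      refine ⟨fun i => g.1.mulVec (X i) + Y i, A, fun i => Submodule.add_mem_sup
        (mulVec_mem_smul_V g (hX i)) (hY i), ?_⟩
      convert hA using 4
      ext i j
      rfl
  rw [this]
  let := zariskiGL r
  refine isOpen_iUnion fun X => isOpen_iUnion fun Y => isOpen_iUnion fun A => ?_
  let R := MvPolynomial (Fin (r + 1) × Fin (r + 1)) ℂ
  let A' : Matrix (Fin d) (Fin (r + 1)) R := A.map MvPolynomial.C
  let G' : Matrix (Fin (r + 1)) (Fin (r + 1)) R := Matrix.of fun i j => MvPolynomial.X (i, j)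
  let X' : Matrix (Fin (r + 1)) (Fin d) R := (Matrix.of X.1).transpose.map MvPolynomial.C
  let Y' : Matrix (Fin (r + 1)) (Fin d) R := (Matrix.of Y.1).transpose.map MvPolynomial.C
  let N : Matrix (Fin d) (Fin d) R := A' * (G' * X' + Y')
  have hf : ∀ c : Fin (r + 1) × Fin (r + 1) → ℂ, MvPolynomial.eval c N.det =
      (A * ((Matrix.of fun i j => c (i, j)) * (Matrix.of X.1).transpose +
        (Matrix.of Y.1).transpose)).det := by
    intro c
    rw [RingHom.map_det, RingHom.mapMatrix_apply]
    congr 1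
    ext i j
    simp [N, A', G', X', Y', Matrix.mul_apply]
  have := isOpen_eval_ne_zero N.det
  simp only [hf] at this
  exact this

/-! ### The fibres of the projections `π_α` -/

theorem replaceAt_castSucc (v : Fin (r + 1) → Vec r) (a : Fin r) (x y : Vec r) :
    replaceAt v a x y a.castSucc = x := by
  rw [replaceAt, Function.update_of_ne Fin.castSucc_lt_succ.ne, Function.update_self]

theorem replaceAt_succ (v : Fin (r + 1) → Vec r) (a : Fin r) (x y : Vec r) :
    replaceAt v a x y a.succ = y := by
  rw [replaceAt, Function.update_self]

theorem replaceAt_of_ne (v : Fin (r + 1) → Vec r) (a : Fin r) (x y : Vec r) {m : Fin (r + 1)}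
    (h : m ≠ a.castSucc) (h' : m ≠ a.succ) : replaceAt v a x y m = v m := by
  rw [replaceAt, Function.update_of_ne h', Function.update_of_ne h]

theorem replaceAt_self (v : Fin (r + 1) → Vec r) (a : Fin r) :
    replaceAt v a (v a.castSucc) (v a.succ) = v := by
  rw [replaceAt, Function.update_eq_self, Function.update_eq_self]

theorem forall_replaceAt {v : Fin (r + 1) → Vec r} {a : Fin r} {x y : Vec r}
    {p : Fin (r + 1) → Vec r → Prop} (hx : p a.castSucc x) (hy : p a.succ y)
    (h : ∀ m, m ≠ a.castSucc → m ≠ a.succ → p m (v m)) (m : Fin (r + 1)) :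
    p m (replaceAt v a x y m) := by
  by_cases h1 : m = a.castSucc
  · rw [h1, replaceAt_castSucc]
    exact hx
  by_cases h2 : m = a.succ
  · rw [h2, replaceAt_succ]
    exact hy
  rw [replaceAt_of_ne _ _ _ _ h1 h2]
  exact h m h1 h2

theorem replaceAt_flip (v : Fin (r + 1) → Vec r) (a : Fin r) :
    replaceAt v a (v a.succ) (v a.castSucc) = fun m => v (Equiv.swap a.castSucc a.succ m) := by
  funext m
  refine forall_replaceAt (p := fun m w => w = v (Equiv.swap a.castSucc a.succ m)) ?_ ?_ ?_ m
  · rw [Equiv.swap_apply_left]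
  · rw [Equiv.swap_apply_right]
  · intro m h h'
    rw [Equiv.swap_apply_of_ne_of_ne h h']

theorem replaceAt_replaceAt (v : Fin (r + 1) → Vec r) (a : Fin r) (x y x' y' : Vec r) :
    replaceAt (replaceAt v a x y) a x' y' = replaceAt v a x' y' := by
  funext m
  refine (forall_replaceAt
    (p := fun m w => w = replaceAt (replaceAt v a x y) a x' y' m) ?_ ?_ ?_ m).symm
  · rw [replaceAt_castSucc]
  · rw [replaceAt_succ]
  · intro m h1 h2
    rw [replaceAt_of_ne _ _ _ _ h1 h2, replaceAt_of_ne _ _ _ _ h1 h2]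

theorem piRoot_eq_iff {a : Fin r} {F G : CompleteFlag r} :
    piRoot a F = piRoot a G ↔ ∀ k, k ≠ a.succ.castSucc → F.V k = G.V k := by
  simp only [funext_iff, Subtype.forall]
  rfl

theorem piRoot_smul {a : Fin r} {F G : CompleteFlag r} (h : piRoot a F = piRoot a G)
    (b : GLn r) : piRoot a (b • F) = piRoot a (b • G) := by
  rw [piRoot_eq_iff] at h ⊢
  intro k hk
  rw [smul_V, smul_V, h k hk]

theorem castSucc_castSucc_ne (a : Fin r) : a.castSucc.castSucc ≠ a.succ.castSucc := by
  simp [Fin.ext_iff]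

theorem succ_succ_ne (a : Fin r) : a.succ.succ ≠ a.succ.castSucc := by
  simp [Fin.ext_iff]

theorem piRoot_eq_of_spannedBy_replaceAt {a : Fin r} {F G : CompleteFlag r}
    {v : Fin (r + 1) → Vec r} {x y : Vec r} (hF : F.SpannedBy v)
    (hG : G.SpannedBy (replaceAt v a x y)) (hx : x ∈ F.V a.succ.succ) (hy : y ∈ F.V a.succ.succ) :
    piRoot a G = piRoot a F := by
  rw [piRoot_eq_iff]
  intro k hk
  refine Submodule.eq_of_le_of_finrank_eq (hG.le_iff.2 fun m => ?_)
    ((G.finrank_eq k).trans (F.finrank_eq k).symm)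
  have hk' : (k : ℕ) ≠ a + 1 := fun h => hk (Fin.ext h)
  refine forall_replaceAt (p := fun m w => m.castSucc < k → w ∈ F.V k) ?_ ?_
    (fun m _ _ hm => hF.mem hm) m
  · intro h
    refine F.mono ?_ hx
    simp only [Fin.lt_def, Fin.le_def, Fin.val_castSucc, Fin.val_succ] at h ⊢
    omega
  · intro h
    refine F.mono ?_ hy
    simp only [Fin.lt_def, Fin.le_def, Fin.val_castSucc, Fin.val_succ] at h ⊢
    omega

/-- A single `g` serves both flags, as the definition of a complex root demands. -/
theorem exists_flip {F : CompleteFlag r} {v : Fin (r + 1) → Vec r} (hF : F.SpannedBy v)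
    (a : Fin r) : ∃ g : GLn r, F = g • stdFlag r ∧
      (g • weylFlag (Equiv.swap a.castSucc a.succ)).SpannedBy
        (replaceAt v a (v a.succ) (v a.castSucc)) := by
  obtain ⟨g, hg⟩ := hF.exists_mulVec_eq
  refine ⟨g, hF.eq_smul_stdFlag hg, ?_⟩
  have := (weylFlag_spannedBy (Equiv.swap a.castSucc a.succ)).smul g
  simp only [hg] at this
  rwa [replaceAt_flip]

/-- The finite points of the fibre, lifted to `GL(n)` by right multiplication with a transvection.
The lift is affine in `t`, which is what `mem_of_isClosed_zariskiGL` needs. -/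
theorem exists_shear {F : CompleteFlag r} {v : Fin (r + 1) → Vec r} (hF : F.SpannedBy v)
    (a : Fin r) : ∃ (γ : ℂ → GLn r) (X Y : Matrix (Fin (r + 1)) (Fin (r + 1)) ℂ),
      (∀ t, (γ t).1 = X + t • Y) ∧ ∀ t, (γ t • stdFlag r).SpannedBy
        (replaceAt v a (v a.castSucc + t • v a.succ) (v a.succ)) := by
  obtain ⟨g, hg⟩ := hF.exists_mulVec_eq
  let T : ℂ → GLn r := fun t => Matrix.GeneralLinearGroup.mkOfDetNeZero
    (Matrix.transvection a.succ a.castSucc t) (by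
      rw [Matrix.det_transvection_of_ne _ _ Fin.castSucc_lt_succ.ne']
      exact one_ne_zero)
  refine ⟨fun t => g * T t, g.1, g.1 * Matrix.single a.succ a.castSucc 1, fun t => ?_,
    fun t => ?_⟩
  · change g.1 * (1 + Matrix.single a.succ a.castSucc t) = _
    rw [Matrix.mul_add, Matrix.mul_one, ← Matrix.mul_smul, Matrix.smul_single, smul_eq_mul, mul_one]
  · have h := stdFlag_spannedBy.smul (g * T t)
    have hT : ∀ m, (T t).1.mulVec (e m) =
        e m + (if m = a.castSucc then t else 0) • (e a.succ : Vec r) := by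
      intro m
      change (1 + Matrix.single a.succ a.castSucc t).mulVec (e m) = _
      rw [Matrix.add_mulVec, Matrix.one_mulVec, e, Matrix.mulVec_single_one]
      congr 1
      ext l
      simp only [Matrix.col_apply, Matrix.single_apply, Pi.smul_apply, e_apply, smul_eq_mul]
      grind
    convert h using 1
    funext m
    symm
    refine forall_replaceAt
      (p := fun m w => ((g * T t : GLn r) : Matrix _ _ ℂ).mulVec (e m) = w) ?_ ?_ ?_ m
    · rw [Units.val_mul, ← Matrix.mulVec_mulVec, hT, if_pos rfl, Matrix.mulVec_add,
        Matrix.mulVec_smul, hg, hg]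
    · rw [Units.val_mul, ← Matrix.mulVec_mulVec, hT, if_neg Fin.castSucc_lt_succ.ne', zero_smul,
        add_zero, hg]
    · intro m h1 _
      rw [Units.val_mul, ← Matrix.mulVec_mulVec, hT, if_neg h1, zero_smul, add_zero, hg]

/-- The points of the fibre of `π_α` through `F`, a projective line. -/
theorem spannedBy_of_piRoot_eq {a : Fin r} {F G : CompleteFlag r} {v : Fin (r + 1) → Vec r}
    (hF : F.SpannedBy v) (h : piRoot a G = piRoot a F) :
    G.SpannedBy (replaceAt v a (v a.succ) (v a.castSucc)) ∨
      ∃ t : ℂ, G.SpannedBy (replaceAt v a (v a.castSucc + t • v a.succ) (v a.succ)) := by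
  rw [piRoot_eq_iff] at h
  have h0 := h _ (castSucc_castSucc_ne a)
  have h2 := h _ (succ_succ_ne a)
  have hoff : ∀ m : Fin (r + 1), m ≠ a.castSucc → m ≠ a.succ → v m ∈ G.V m.succ := by
    intro m hm _
    rw [h]
    · exact hF.mem_succ m
    · intro h
      exact hm (Fin.succ_injective _ h)
  have hnot : ¬ G.V a.succ.castSucc ≤ G.V a.castSucc.castSucc := by
    intro hle
    have := Submodule.finrank_mono hle
    rw [G.finrank_eq, G.finrank_eq] at this
    simp at this
  -- Modulo the common subspace of dimension `a`, the vector `u` is `s x + t y` with `x`, `y` the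
  -- two vectors of `v`. The point of the projective line is `[s : t]`: `s = 0` gives the flip,
  -- otherwise the parameter is `t / s`.
  obtain ⟨u, hu, hu'⟩ := SetLike.not_le_iff_exists.1 hnot
  have hu2 : u ∈ F.V a.castSucc.castSucc ⊔ Submodule.span ℂ {v a.castSucc, v a.succ} := by
    have hu1 : u ∈ F.V a.succ.succ := h2 ▸ G.mono (Fin.castSucc_le_succ _) hu
    refine hF.le_iff.2 (fun m hm => ?_) hu1
    by_cases h1 : m = a.castSucc
    · exact Submodule.mem_sup_right (Submodule.subset_span (by simp [h1]))
    by_cases h2 : m = a.succ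
    · exact Submodule.mem_sup_right (Submodule.subset_span (by simp [h2]))
    refine Submodule.mem_sup_left (hF.mem ?_)
    simp only [Fin.lt_def, Fin.ext_iff, Fin.val_castSucc, Fin.val_succ] at h1 h2 hm ⊢
    omega
  obtain ⟨u0, hu0, w, hw, rfl⟩ := Submodule.mem_sup.1 hu2
  obtain ⟨s, t, rfl⟩ := Submodule.mem_span_pair.1 hw
  have hw1 : s • v a.castSucc + t • v a.succ ∈ G.V a.succ.castSucc := by
    rw [← h0] at hu0
    have h01 := G.mono (show a.castSucc.castSucc ≤ a.succ.castSucc by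
      simp [Fin.le_def]) hu0
    simpa using Submodule.sub_mem _ hu h01
  have hx : v a.castSucc ∈ G.V a.succ.succ := h2 ▸ hF.mem (by simp [Fin.lt_def])
  have hy : v a.succ ∈ G.V a.succ.succ := h2 ▸ hF.mem (by simp [Fin.lt_def])
  by_cases hs : s = 0
  · left
    have ht : t ≠ 0 := by
      rintro rfl
      refine hu' ?_
      rw [h0]
      simpa [hs] using hu0
    obtain ⟨g, -, hg⟩ := exists_flip hF a
    convert hg
    refine (hg.eq_of_mem fun m => forall_replaceAt (p := fun m w => w ∈ G.V m.succ) ?_ ?_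
      hoff m).symm
    · rw [hs, zero_smul, zero_add] at hw1
      exact (Submodule.smul_mem_iff _ ht).1 hw1
    · exact hx
  · right
    refine ⟨s⁻¹ * t, ?_⟩
    obtain ⟨γ, -, -, -, hg⟩ := exists_shear hF a
    convert hg (s⁻¹ * t)
    refine ((hg _).eq_of_mem fun m => forall_replaceAt (p := fun m w => w ∈ G.V m.succ) ?_ ?_
      hoff m).symm
    · have := Submodule.smul_mem _ s⁻¹ hw1
      rwa [smul_add, smul_smul, smul_smul, inv_mul_cancel₀ hs, one_smul] at this
    · exact hy

/-- Change of chart on the projective line: `y + t x` is proportional to `x + t⁻¹ y`. It lets the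
flip be treated as an origin in the density argument. -/
theorem spannedBy_shear_of_flip {a : Fin r} {F G : CompleteFlag r} {v : Fin (r + 1) → Vec r}
    (hF : F.SpannedBy v) {t : ℂ} (ht : t ≠ 0)
    (h : G.SpannedBy (replaceAt v a (v a.succ + t • v a.castSucc) (v a.castSucc))) :
    G.SpannedBy (replaceAt v a (v a.castSucc + t⁻¹ • v a.succ) (v a.succ)) := by
  obtain ⟨γ, -, -, -, hg⟩ := exists_shear hF a
  have hx := h.mem_succ a.castSucc
  have hy := h.mem_succ a.succ
  rw [replaceAt_castSucc] at hx
  rw [replaceAt_succ] at hy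
  convert hg t⁻¹
  refine ((hg _).eq_of_mem fun m => forall_replaceAt (p := fun m w => w ∈ G.V m.succ) ?_ ?_
    ?_ m).symm
  · have := Submodule.smul_mem _ t⁻¹ hx
    rw [smul_add, smul_smul, inv_mul_cancel₀ ht, one_smul] at this
    rwa [add_comm (v _)]
  · have := Submodule.sub_mem _ (G.mono (Fin.castSucc_le_succ a.succ) hx)
      (Submodule.smul_mem _ t hy)
    rwa [add_sub_cancel_right] at this
  · intro m h1 h2
    have := h.mem_succ m
    rwa [replaceAt_of_ne _ _ _ _ h1 h2] at this

/-! ### Orbits and their saturations -/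

section Orbits

variable {M : Subgroup (GLn r)}

theorem mem_orb {F G : CompleteFlag r} : G ∈ orb M F ↔ ∃ b ∈ M, b • F = G := by
  constructor
  · rintro ⟨b, rfl⟩
    exact ⟨b, b.2, rfl⟩
  · rintro ⟨b, hb, rfl⟩
    exact ⟨⟨b, hb⟩, rfl⟩

theorem self_mem_orb (F : CompleteFlag r) : F ∈ orb M F := MulAction.mem_orbit_self F

theorem orb_eq_iff {F G : CompleteFlag r} : orb M F = orb M G ↔ F ∈ orb M G :=
  MulAction.orbit_eq_iff

theorem mem_orb_comm {F G : CompleteFlag r} : F ∈ orb M G ↔ G ∈ orb M F :=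
  MulAction.mem_orbit_symm

theorem smul_mem_orb_iff {F G : CompleteFlag r} {b : GLn r} (hb : b ∈ M) :
    b • F ∈ orb M G ↔ F ∈ orb M G := by
  rw [← orb_eq_iff, ← orb_eq_iff (F := F), orb_eq_iff.2 (mem_orb.2 ⟨b, hb, rfl⟩)]

theorem mem_sat_orb {a : Fin r} {F G : CompleteFlag r} :
    G ∈ sat a (orb M F) ↔ ∃ b ∈ M, ∃ H, piRoot a H = piRoot a F ∧ b • H = G := by
  constructor
  · rintro ⟨F', hF', h⟩
    obtain ⟨b, hb, rfl⟩ := mem_orb.1 hF'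
    refine ⟨b, hb, b⁻¹ • G, ?_, smul_inv_smul b G⟩
    rw [← piRoot_smul h b⁻¹, inv_smul_smul]
  · rintro ⟨b, hb, H, hH, rfl⟩
    exact ⟨b • F, mem_orb.2 ⟨b, hb, rfl⟩, (piRoot_smul hH b).symm⟩

theorem orb_subset_sat {a : Fin r} {F H : CompleteFlag r} (h : piRoot a H = piRoot a F) :
    orb M H ⊆ sat a (orb M F) := by
  intro G hG
  obtain ⟨b, hb, rfl⟩ := mem_orb.1 hG
  exact mem_sat_orb.2 ⟨b, hb, H, h, rfl⟩

/-! ### Stable subspaces that separate the orbits over a fibre. -/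

/-- The subspace `Z` is stable under the group `M`. -/
def Stable (M : Subgroup (GLn r)) (Z : Submodule ℂ (Vec r)) : Prop :=
  ∀ b ∈ M, ∀ z ∈ Z, b.1.mulVec z ∈ Z

theorem Stable.map_eq {Z : Submodule ℂ (Vec r)} (hZ : Stable M Z) {b : GLn r} (hb : b ∈ M) :
    Z.map (Matrix.toLin' b.1) = Z := by
  refine le_antisymm (Submodule.map_le_iff_le_comap.2 (hZ b hb)) fun z hz =>
    ⟨b⁻¹.1.mulVec z, hZ _ (M.inv_mem hb) z hz, ?_⟩
  rw [Matrix.toLin'_apply, Matrix.mulVec_mulVec, ← Units.val_mul, mul_inv_cancel, Units.val_one,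
    Matrix.one_mulVec]

/-- The subspace of dimension `a + 1` of `F` is not contained in `Z` modulo that of
dimension `a`. -/
def Escapes (a : Fin r) (Z : Submodule ℂ (Vec r)) (F : CompleteFlag r) : Prop :=
  ¬ F.V a.succ.castSucc ≤ F.V a.castSucc.castSucc ⊔ Z

theorem Escapes.smul {a : Fin r} {Z : Submodule ℂ (Vec r)} (hZ : Stable M Z) {F : CompleteFlag r}
    (h : Escapes a Z F) {b : GLn r} (hb : b ∈ M) : Escapes a Z (b • F) := by
  intro hle
  refine h ?_
  rw [smul_V, smul_V, ← hZ.map_eq hb, ← Submodule.map_sup] at hle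
  intro x hx
  obtain ⟨y, hy, hxy⟩ := hle ⟨x, hx, rfl⟩
  have hinj : Function.Injective (Matrix.toLin' b.1) :=
    Matrix.mulVec_injective_of_isUnit b.isUnit
  rwa [← hinj hxy]

theorem escapes_smul_iff {a : Fin r} {Z : Submodule ℂ (Vec r)} (hZ : Stable M Z)
    {F : CompleteFlag r} {b : GLn r} (hb : b ∈ M) : Escapes a Z (b • F) ↔ Escapes a Z F := by
  refine ⟨fun h => ?_, fun h => h.smul hZ hb⟩
  have := h.smul hZ (M.inv_mem hb)
  rwa [inv_smul_smul] at this

theorem escapes_iff_of_mem_orb {a : Fin r} {Z : Submodule ℂ (Vec r)} (hZ : Stable M Z)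
    {F G : CompleteFlag r} (h : G ∈ orb M F) : Escapes a Z G ↔ Escapes a Z F := by
  obtain ⟨b, hb, rfl⟩ := mem_orb.1 h
  exact escapes_smul_iff hZ hb

theorem not_escapes_of_mem {a : Fin r} {Z : Submodule ℂ (Vec r)} {F : CompleteFlag r}
    {v : Fin (r + 1) → Vec r} (hF : F.SpannedBy v) (h : v a.castSucc ∈ Z) : ¬ Escapes a Z F := by
  rw [Escapes, not_not, hF.le_iff]
  intro m hm
  by_cases h1 : m = a.castSucc
  · exact Submodule.mem_sup_right (h1 ▸ h)
  refine Submodule.mem_sup_left (hF.mem ?_)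
  simp only [Fin.lt_def, Fin.ext_iff, Fin.val_castSucc, Fin.val_succ] at h1 hm ⊢
  omega

/-- The form `f` kills the subspace of dimension `a`, shared by `F` and `G`, and kills `Z`; so one
vector with `f u ≠ 0` certifies escape. -/
theorem escapes_of_dual {a : Fin r} {Z : Submodule ℂ (Vec r)} {F G : CompleteFlag r}
    (hG : piRoot a G = piRoot a F) (f : Vec r →ₗ[ℂ] ℂ)
    (hf : ∀ x ∈ F.V a.castSucc.castSucc, f x = 0) (hfZ : ∀ x ∈ Z, f x = 0) {u : Vec r}
    (hu : u ∈ G.V a.succ.castSucc) (hfu : f u ≠ 0) : Escapes a Z G := by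
  intro hle
  rw [piRoot_eq_iff.1 hG _ (castSucc_castSucc_ne a)] at hle
  have : F.V a.castSucc.castSucc ⊔ Z ≤ LinearMap.ker f := sup_le hf hfZ
  exact hfu (this (hle hu))

/-- Over the saturation, the dimension of the `a`-th subspace plus `Z` is constant, since the fibre
does not change that subspace and `M` preserves `Z`. Escaping thus means that the next subspace plus
`Z` has dimension at least this constant plus one, an open condition. -/
theorem exists_isOpen_escapes (a : Fin r) {Z : Submodule ℂ (Vec r)} (hZ : Stable M Z)
    (F : CompleteFlag r) : ∃ U : Set (CompleteFlag r), IsOpen U ∧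
      ∀ G ∈ sat a (orb M F), G ∈ U ↔ Escapes a Z G := by
  refine ⟨_, isOpen_le_finrank_sup a.succ.castSucc Z
    (Module.finrank ℂ ↥(F.V a.castSucc.castSucc ⊔ Z) + 1), fun G hG => ?_⟩
  obtain ⟨b, hb, H, hH, rfl⟩ := mem_sat_orb.1 hG
  rw [escapes_smul_iff hZ hb]
  have hmap : ∀ W : Submodule ℂ (Vec r), Module.finrank ℂ ↥(W.map (Matrix.toLin' b.1) ⊔ Z) =
      Module.finrank ℂ ↥(W ⊔ Z) := by
    intro W
    have hinj : Function.Injective (Matrix.toLin' b.1) :=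
      Matrix.mulVec_injective_of_isUnit b.isUnit
    conv_lhs => rw [← hZ.map_eq hb, ← Submodule.map_sup]
    exact (Submodule.equivMapOfInjective _ hinj _).finrank_eq.symm
  have h0 := piRoot_eq_iff.1 hH _ (castSucc_castSucc_ne a)
  rw [Set.mem_ofPred_eq, smul_V, hmap, Escapes, ← h0, Nat.succ_le_iff]
  constructor
  · intro hlt hle
    exact hlt.not_ge (Submodule.finrank_mono (sup_le hle le_sup_right))
  · intro h
    refine Submodule.finrank_lt_finrank_of_lt (lt_of_le_not_ge
      (sup_le_sup_right (H.mono ?_) _) fun hle => h (le_sup_left.trans hle))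
    simp [Fin.le_def]

/-! ### Closure along a shear, and the criteria for two or three orbits. -/

/-- Each translate `b • F` is the value at `t = 0` of `b γ(t) F_+`, which lies in the orbit of `G`
for all other `t`. -/
theorem orb_subset_closure {a : Fin r} {F G : CompleteFlag r} {v : Fin (r + 1) → Vec r}
    (hF : F.SpannedBy v) (h : ∀ (t : ℂ) (H : CompleteFlag r), t ≠ 0 →
      H.SpannedBy (replaceAt v a (v a.castSucc + t • v a.succ) (v a.succ)) → H ∈ orb M G) :
    orb M F ⊆ closure (orb M G) := by
  intro H hH
  obtain ⟨b, hb, rfl⟩ := mem_orb.1 hH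
  obtain ⟨γ, X, Y, hγ, hs⟩ := exists_shear hF a
  have hF0 : F = γ 0 • stdFlag r := by
    have := hs 0
    rw [zero_smul, add_zero, replaceAt_self] at this
    exact hF.unique this
  rintro C ⟨hC, hGC⟩
  have hC' : IsClosed[zariskiGL r] ((fun g : GLn r => g • stdFlag r) ⁻¹' C) :=
    (@isClosed_coinduced _ _ (zariskiGL r) _ _).1 hC
  have := mem_of_isClosed_zariskiGL hC' (fun t => b * γ t) (b.1 * X) (b.1 * Y) (fun t => by
    rw [Units.val_mul, hγ, Matrix.mul_add, Matrix.mul_smul]) fun t ht => hGC (by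
      change (b * γ t) • stdFlag r ∈ _
      rw [mul_smul, smul_mem_orb_iff hb]
      exact h t _ ht (hs t))
  rw [Set.mem_preimage, mul_smul, ← hF0] at this
  exact this

/-- All fibre points other than `F` lie in the orbit of the flip. The subspace `Z` contains the
first of the two vectors, so `F` does not escape it, while `f` shows that the flip does. -/
theorem isComplexStable_and_monoidAct {a : Fin r} {F F' : CompleteFlag r}
    {v : Fin (r + 1) → Vec r} (hF : F.SpannedBy v)
    (hF' : F'.SpannedBy (replaceAt v a (v a.succ) (v a.castSucc)))
    {Z : Submodule ℂ (Vec r)} (hZ : Stable M Z) (hx : v a.castSucc ∈ Z) (f : Vec r →ₗ[ℂ] ℂ)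
    (hf : ∀ u ∈ F.V a.castSucc.castSucc, f u = 0) (hfZ : ∀ u ∈ Z, f u = 0)
    (hfy : f (v a.succ) ≠ 0)
    (h : ∀ (t : ℂ) (H : CompleteFlag r), t ≠ 0 →
      H.SpannedBy (replaceAt v a (v a.castSucc + t • v a.succ) (v a.succ)) → H ∈ orb M F') :
    IsComplexStable M a (orb M F) ∧ MonoidAct M a (orb M F) (orb M F') := by
  have hxF : v a.castSucc ∈ F.V a.succ.succ := hF.mem (by simp [Fin.lt_def])
  have hπ : piRoot a F' = piRoot a F :=
    piRoot_eq_of_spannedBy_replaceAt hF hF' (hF.mem_succ _) hxF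
  have hyF' : v a.succ ∈ F'.V a.succ.castSucc := by
    have := hF'.mem_succ a.castSucc
    rwa [replaceAt_castSucc] at this
  have hesc : ¬ Escapes a Z F := not_escapes_of_mem hF hx
  have hesc' : Escapes a Z F' := escapes_of_dual hπ f hf hfZ hyF' hfy
  have hne : orb M F' ≠ orb M F := fun heq =>
    hesc ((escapes_iff_of_mem_orb hZ (orb_eq_iff.1 heq)).1 hesc')
  have hsat : sat a (orb M F) = orb M F ∪ orb M F' := by
    refine Set.Subset.antisymm (fun G hG => ?_)
      (Set.union_subset (orb_subset_sat rfl) (orb_subset_sat hπ))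
    obtain ⟨b, hb, H, hH, rfl⟩ := mem_sat_orb.1 hG
    rw [Set.mem_union, smul_mem_orb_iff hb, smul_mem_orb_iff hb]
    rcases spannedBy_of_piRoot_eq hF hH with h1 | ⟨t, h1⟩
    · exact Or.inr (h1.unique hF' ▸ self_mem_orb _)
    · by_cases ht : t = 0
      · rw [ht, zero_smul, add_zero, replaceAt_self] at h1
        exact Or.inl (h1.unique hF ▸ self_mem_orb _)
      · exact Or.inr (h t H ht h1)
  have hact : MonoidAct M a (orb M F) (orb M F') := by
    refine ⟨⟨F', rfl⟩, orb_subset_sat hπ, ?_, ?_⟩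
    · obtain ⟨U, hU, hUG⟩ := exists_isOpen_escapes a hZ F
      refine ⟨U, hU, Set.Subset.antisymm (fun G hG => ⟨orb_subset_sat hπ hG, ?_⟩) ?_⟩
      · rw [hUG G (orb_subset_sat hπ hG), escapes_iff_of_mem_orb hZ hG]
        exact hesc'
      · rintro G ⟨hG, hGU⟩
        rw [hUG G hG] at hGU
        rw [hsat] at hG
        exact hG.resolve_left fun hG => hesc ((escapes_iff_of_mem_orb hZ hG).1 hGU)
    · rw [hsat]
      exact Set.union_subset (orb_subset_closure hF h) subset_closure
  obtain ⟨g, rfl, hg⟩ := exists_flip hF a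
  obtain rfl := hF'.unique hg
  exact ⟨⟨⟨g, rfl, hne, hsat⟩, _, hact, hne⟩, hact⟩

/-- The three orbits are told apart by two stable subspaces: `F` does not escape `Z₁`, the flip
escapes `Z₁` but not `Z₂`, and a shear with `t ≠ 0` escapes both. The last orbit is therefore cut
out by the intersection of two open conditions. -/
theorem isNoncompact_and_monoidAct {a : Fin r} {F G : CompleteFlag r}
    {v : Fin (r + 1) → Vec r} (hF : F.SpannedBy v)
    {Z₁ Z₂ : Submodule ℂ (Vec r)} (hZ₁ : Stable M Z₁) (hZ₂ : Stable M Z₂)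
    (hx : v a.castSucc ∈ Z₁) (hy : v a.succ ∈ Z₂) (f₁ f₂ : Vec r →ₗ[ℂ] ℂ)
    (hf₁ : ∀ u ∈ F.V a.castSucc.castSucc, f₁ u = 0)
    (hf₂ : ∀ u ∈ F.V a.castSucc.castSucc, f₂ u = 0)
    (hfZ₁ : ∀ u ∈ Z₁, f₁ u = 0) (hfZ₂ : ∀ u ∈ Z₂, f₂ u = 0)
    (hfy : f₁ (v a.succ) ≠ 0) (hfx : f₂ (v a.castSucc) ≠ 0)
    (h : ∀ (t : ℂ) (H : CompleteFlag r), t ≠ 0 →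
      H.SpannedBy (replaceAt v a (v a.castSucc + t • v a.succ) (v a.succ)) → H ∈ orb M G) :
    IsNoncompact M a (orb M F) ∧ MonoidAct M a (orb M F) (orb M G) := by
  have hxF : v a.castSucc ∈ F.V a.succ.succ := hF.mem (by simp [Fin.lt_def])
  have hyF : v a.succ ∈ F.V a.succ.succ := hF.mem_succ _
  obtain ⟨g, -, hF'⟩ := exists_flip hF a
  set F' := g • weylFlag (Equiv.swap a.castSucc a.succ)
  obtain ⟨γ, -, -, -, hγ⟩ := exists_shear hF a
  have hF₁ := hγ 1
  set F₁ := γ 1 • stdFlag r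
  have hF₁G : F₁ ∈ orb M G := h 1 F₁ one_ne_zero hF₁
  -- The orbit of `G` is represented from here on by the explicit fibre point with `t = 1`.
  rw [← orb_eq_iff.2 hF₁G] at h ⊢
  have hπ : piRoot a F' = piRoot a F := piRoot_eq_of_spannedBy_replaceAt hF hF' hyF hxF
  have hπ₁ : piRoot a F₁ = piRoot a F := piRoot_eq_of_spannedBy_replaceAt hF hF₁
    (Submodule.add_mem _ hxF (Submodule.smul_mem _ _ hyF)) hyF
  have hyF' : v a.succ ∈ F'.V a.succ.castSucc := by
    have := hF'.mem_succ a.castSucc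
    rwa [replaceAt_castSucc] at this
  have hxF₁ : v a.castSucc + (1 : ℂ) • v a.succ ∈ F₁.V a.succ.castSucc := by
    have := hF₁.mem_succ a.castSucc
    rwa [replaceAt_castSucc] at this
  have hF_esc : ¬ Escapes a Z₁ F := not_escapes_of_mem hF hx
  have hF'_esc₁ : Escapes a Z₁ F' := escapes_of_dual hπ f₁ hf₁ hfZ₁ hyF' hfy
  have hF'_esc₂ : ¬ Escapes a Z₂ F' :=
    not_escapes_of_mem hF' (by rwa [replaceAt_castSucc])
  have hF₁_esc₁ : Escapes a Z₁ F₁ := escapes_of_dual hπ₁ f₁ hf₁ hfZ₁ hxF₁ (by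
    rwa [map_add, hfZ₁ _ hx, zero_add, one_smul])
  have hF₁_esc₂ : Escapes a Z₂ F₁ := escapes_of_dual hπ₁ f₂ hf₂ hfZ₂ hxF₁ (by
    rwa [map_add, one_smul, hfZ₂ _ hy, add_zero])
  have hne' : orb M F ≠ orb M F' := fun heq =>
    hF_esc ((escapes_iff_of_mem_orb hZ₁ (orb_eq_iff.1 heq)).2 hF'_esc₁)
  have hne₁ : orb M F ≠ orb M F₁ := fun heq =>
    hF_esc ((escapes_iff_of_mem_orb hZ₁ (orb_eq_iff.1 heq)).2 hF₁_esc₁)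
  have hne₂ : orb M F' ≠ orb M F₁ := fun heq =>
    hF'_esc₂ ((escapes_iff_of_mem_orb hZ₂ (orb_eq_iff.1 heq)).2 hF₁_esc₂)
  have hsat : ∀ H ∈ sat a (orb M F), H ∈ orb M F ∨ H ∈ orb M F' ∨ H ∈ orb M F₁ := by
    intro H' hH'
    obtain ⟨b, hb, H, hH, rfl⟩ := mem_sat_orb.1 hH'
    rw [smul_mem_orb_iff hb, smul_mem_orb_iff hb, smul_mem_orb_iff hb]
    rcases spannedBy_of_piRoot_eq hF hH with h1 | ⟨t, h1⟩
    · exact Or.inr (Or.inl (h1.unique hF' ▸ self_mem_orb _))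
    · by_cases ht : t = 0
      · rw [ht, zero_smul, add_zero, replaceAt_self] at h1
        exact Or.inl (h1.unique hF ▸ self_mem_orb _)
      · exact Or.inr (Or.inr (h t H ht h1))
  have hact : MonoidAct M a (orb M F) (orb M F₁) := by
    refine ⟨⟨F₁, rfl⟩, orb_subset_sat hπ₁, ?_, ?_⟩
    · obtain ⟨U₁, hU₁, hUG₁⟩ := exists_isOpen_escapes a hZ₁ F
      obtain ⟨U₂, hU₂, hUG₂⟩ := exists_isOpen_escapes a hZ₂ F
      refine ⟨U₁ ∩ U₂, hU₁.inter hU₂, Set.Subset.antisymm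
        (fun H hH => ⟨orb_subset_sat hπ₁ hH, ?_⟩) ?_⟩
      · rw [Set.mem_inter_iff, hUG₁ H (orb_subset_sat hπ₁ hH), hUG₂ H (orb_subset_sat hπ₁ hH),
          escapes_iff_of_mem_orb hZ₁ hH, escapes_iff_of_mem_orb hZ₂ hH]
        exact ⟨hF₁_esc₁, hF₁_esc₂⟩
      · rintro H ⟨hH, hHU₁, hHU₂⟩
        rw [hUG₁ H hH] at hHU₁
        rw [hUG₂ H hH] at hHU₂
        rcases hsat H hH with hH | hH | hH
        · exact absurd ((escapes_iff_of_mem_orb hZ₁ hH).1 hHU₁) hF_esc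
        · exact absurd ((escapes_iff_of_mem_orb hZ₂ hH).1 hHU₂) hF'_esc₂
        · exact hH
    · intro H hH
      rcases hsat H hH with hH | hH | hH
      · exact orb_subset_closure hF h hH
      -- The flip is approached in the chart at infinity, where the parameter `t` becomes `t⁻¹`.
      · refine orb_subset_closure (a := a) hF' (fun t H ht hH => ?_) hH
        rw [replaceAt_castSucc, replaceAt_succ] at hH
        refine h t⁻¹ H (inv_ne_zero ht) (spannedBy_shear_of_flip hF ht ?_)
        rwa [replaceAt_replaceAt] at hH
      · exact subset_closure hH
  refine ⟨⟨Set.ncard_eq_three.2 ⟨_, _, _, hne', hne₁, hne₂, ?_⟩, _, hact, hne₁.symm⟩, hact⟩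
  ext O
  simp only [Set.mem_ofPred_eq, Set.mem_insert_iff, Set.mem_singleton_iff]
  constructor
  · rintro ⟨⟨H, rfl⟩, hO⟩
    rw [orb_eq_iff, orb_eq_iff, orb_eq_iff]
    exact hsat H (hO (self_mem_orb H))
  · rintro (rfl | rfl | rfl)
    · exact ⟨⟨F, rfl⟩, orb_subset_sat rfl⟩
    · exact ⟨⟨F', rfl⟩, orb_subset_sat hπ⟩
    · exact ⟨⟨F₁, rfl⟩, orb_subset_sat hπ₁⟩

end Orbits

/-! ### The action of `K` and `B_{n-1}` on vectors -/

theorem e_injective : Function.Injective (e : Fin (r + 1) → Vec r) := by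
  intro k l h
  have := congrFun h k
  rw [e_apply, e_apply, if_pos rfl] at this
  by_contra hkl
  rw [if_neg hkl] at this
  exact one_ne_zero this

theorem eHat_apply (k l : Fin (r + 1)) :
    (eHat k : Vec r) l = (if l = k then 1 else 0) + if l = Fin.last r then 1 else 0 := by
  rw [eHat, Pi.add_apply, e_apply, e_apply]

theorem IsHat.apply_last {w : Vec r} {k : Fin (r + 1)} (h : IsHat w k) : w (Fin.last r) = 1 := by
  rw [h.2, eHat_apply, if_neg h.1.symm, if_pos rfl, zero_add]

theorem IsHat.apply_of_ne {w : Vec r} {k l : Fin (r + 1)} (h : IsHat w k) (hl : l ≠ Fin.last r) :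
    w l = if l = k then 1 else 0 := by
  rw [h.2, eHat_apply, if_neg hl, add_zero]

theorem IsHat.ne_e {w : Vec r} {k : Fin (r + 1)} (h : IsHat w k) (l : Fin (r + 1)) : w ≠ e l := by
  intro heq
  have h1 := h.apply_last
  have h2 := h.apply_of_ne h.1
  rw [heq, e_apply] at h1 h2
  rw [if_pos rfl] at h2
  split_ifs at h1 h2 with h3 h4
  · exact h.1 (h4.trans h3.symm)
  all_goals simp at h1 h2

theorem mulVec_e_last_of_mem_K {g : GLn r} (hg : g ∈ K r) :
    g.1.mulVec (e (Fin.last r)) = e (Fin.last r) := hg.1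

theorem mulVec_apply_last_of_mem_K {g : GLn r} (hg : g ∈ K r) (x : Vec r) :
    g.1.mulVec x (Fin.last r) = x (Fin.last r) := by
  have h := congrArg (fun y : Vec r => y ⬝ᵥ x) hg.2
  rw [← Matrix.dotProduct_mulVec] at h
  simpa [e] using h

theorem apply_last_eq_zero_of_mem_K {g : GLn r} (hg : g ∈ K r) {l : Fin (r + 1)}
    (hl : l ≠ Fin.last r) : g.1 l (Fin.last r) = 0 := by
  have h := congrFun hg.1 l
  rw [e_apply, if_neg hl, e, Matrix.mulVec_single_one] at h
  exact h

/-- Triangularity removes the contributions of coordinates below `p`. The coordinate `n` contributes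
nothing either, because the last column of an element of `K` is `e_n`; hence `x` may have a nonzero
last coordinate, as hat vectors do. -/
theorem mulVec_apply_of_mem_Bsub {b : GLn r} (hb : b ∈ Bsub r) {x : Vec r} {p : Fin (r + 1)}
    (hp : p ≠ Fin.last r) (hx : ∀ l, p < l → l ≠ Fin.last r → x l = 0) :
    b.1.mulVec x p = b.1 p p * x p := by
  rw [Matrix.mulVec, dotProduct]
  refine Finset.sum_eq_single p (fun l _ hl => ?_) (by simp)
  rcases lt_or_gt_of_ne hl with h | h
  · rw [hb.2 h, zero_mul]
  · by_cases hl' : l = Fin.last r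
    · rw [hl', apply_last_eq_zero_of_mem_K hb.1 hp, zero_mul]
    · rw [hx l h hl', mul_zero]

theorem apply_self_ne_zero_of_mem_Bsub {b : GLn r} (hb : b ∈ Bsub r) (p : Fin (r + 1)) :
    b.1 p p ≠ 0 := by
  have h : b.1.det ≠ 0 := (b.1.isUnit_iff_isUnit_det.1 b.isUnit).ne_zero
  rw [Matrix.det_of_isUpperTriangular hb.2, Finset.prod_ne_zero_iff] at h
  exact h p (Finset.mem_univ p)

/-- The vectors with vanishing coordinates in `R`. -/
def coordKer (R : Set (Fin (r + 1))) : Submodule ℂ (Vec r) where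
  carrier := {x | ∀ l ∈ R, x l = 0}
  zero_mem' := fun _ _ => rfl
  add_mem' := fun hx hy l hl => by rw [Pi.add_apply, hx l hl, hy l hl, add_zero]
  smul_mem' := fun c x hx l hl => by rw [Pi.smul_apply, hx l hl, smul_zero]

/-- The coordinate `n` is invariant under `K`, and a coordinate below `n` only receives
contributions from itself and the larger ones below `n`. So `R` must be closed upwards below `n`,
and may or may not contain `n`. -/
theorem stable_coordKer {R : Set (Fin (r + 1))}
    (hR : ∀ l ∈ R, l ≠ Fin.last r → ∀ m, l ≤ m → m ≠ Fin.last r → m ∈ R) :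
    Stable (Bsub r) (coordKer R) := by
  intro b hb x hx l hl
  by_cases hl' : l = Fin.last r
  · subst hl'
    rw [mulVec_apply_last_of_mem_K hb.1]
    exact hx _ hl
  · rw [mulVec_apply_of_mem_Bsub hb hl' fun m hm hm' => hx m (hR l hl hl' m hm.le hm'), hx l hl,
      mul_zero]

/-- The linear form `x_n - ∑_{t ∈ T} x_t`. -/
noncomputable def hatForm (T : Finset (Fin (r + 1))) : Vec r →ₗ[ℂ] ℂ :=
  LinearMap.proj (Fin.last r) - ∑ t ∈ T, (LinearMap.proj t : Vec r →ₗ[ℂ] ℂ)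

theorem hatForm_apply (T : Finset (Fin (r + 1))) (x : Vec r) :
    hatForm T x = x (Fin.last r) - ∑ t ∈ T, x t := by
  simp [hatForm]

/-! ### Sequences in standard form -/

namespace IsStandardSeq

variable {v w : Fin (r + 1) → Vec r} {ℓ ℓ' : Fin (r + 1) → Fin (r + 1)} {F G : CompleteFlag r}

theorem index_of_eq_last (hv : IsStandardSeq v ℓ) {m : Fin (r + 1)} (h : v m = e (Fin.last r)) :
    ℓ m = Fin.last r := by
  rcases hv.vec m with h1 | h1
  · exact e_injective (h1.symm.trans h)
  · exact absurd h (h1.ne_e _)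

theorem eq_last_iff (hv : IsStandardSeq v ℓ) {m : Fin (r + 1)} :
    v m = e (Fin.last r) ↔ ℓ m = Fin.last r := by
  refine ⟨hv.index_of_eq_last, fun h => ?_⟩
  rcases hv.vec m with h1 | h1
  · rw [h1, h]
  · exact absurd h h1.1

theorem apply (hv : IsStandardSeq v ℓ) (m : Fin (r + 1)) {l : Fin (r + 1)}
    (hl : l ≠ Fin.last r) : v m l = if l = ℓ m then 1 else 0 := by
  rcases hv.vec m with h1 | h1
  · rw [h1, e_apply]
  · exact h1.apply_of_ne hl

/-- An index `k < n` that does not occur would make the `k`-th coordinate vanish on the whole space;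
the index `n` occurs because `e_n` does. -/
theorem injective (hv : IsStandardSeq v ℓ) (hF : F.SpannedBy v) : Function.Injective ℓ := by
  refine Finite.injective_iff_surjective.2 fun k => ?_
  by_cases hk : k = Fin.last r
  · obtain ⟨m, hm⟩ := hv.exists_last
    exact ⟨m, hk ▸ hv.index_of_eq_last hm⟩
  by_contra! hne
  have htop : F.V (Fin.last _) = ⊤ := Submodule.eq_top_of_finrank_eq (by
    rw [F.finrank_eq]
    simp)
  have hle : F.V (Fin.last _) ≤ LinearMap.ker (LinearMap.proj k : Vec r →ₗ[ℂ] ℂ) :=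
    hF.le_iff.2 fun m _ => (hv.apply m hk).trans (if_neg (hne m).symm)
  have : e k ∈ LinearMap.ker (LinearMap.proj k : Vec r →ₗ[ℂ] ℂ) := hle (htop ▸ trivial)
  rw [LinearMap.mem_ker, LinearMap.proj_apply, e_apply, if_pos rfl] at this
  exact one_ne_zero this

theorem index_ne_last (hv : IsStandardSeq v ℓ) (hF : F.SpannedBy v) {m j : Fin (r + 1)}
    (hj : v j = e (Fin.last r)) (hm : m ≠ j) : ℓ m ≠ Fin.last r := fun h =>
  hm (hv.injective hF (h.trans (hv.index_of_eq_last hj).symm))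

/-- Makes the position of `e_n` intrinsic to the flag, hence constant on `K`-orbits. -/
theorem mem_V_iff (hv : IsStandardSeq v ℓ) (hF : F.SpannedBy v) {m : Fin (r + 1)} :
    v m = e (Fin.last r) ↔ e (Fin.last r) ∈ F.V m.succ ∧ e (Fin.last r) ∉ F.V m.castSucc := by
  constructor
  · intro h
    rw [← h]
    exact ⟨hF.mem_succ m, hF.notMem m⟩
  · rintro ⟨h1, h2⟩
    obtain ⟨j, hj⟩ := hv.exists_last
    rw [← hj] at h1 h2
    rcases lt_trichotomy j m with h | h | h
    · exact absurd (hF.mem (by simpa using h)) h2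
    · rw [← h, hj]
    · exact absurd (F.mono (Fin.castSucc_lt_iff_succ_le.1
        (Fin.castSucc_lt_castSucc_iff.2 h)) h1) (hF.notMem j)

/-- The indices of the hat vectors before position `c`. -/
noncomputable def hatIndices (v : Fin (r + 1) → Vec r) (ℓ : Fin (r + 1) → Fin (r + 1))
    (c : Fin (r + 1)) : Finset (Fin (r + 1)) := by
  classical exact ({m | m < c ∧ IsHat (v m) (ℓ m)} : Finset (Fin (r + 1))).image ℓ

theorem mem_hatIndices {c t : Fin (r + 1)} :
    t ∈ hatIndices v ℓ c ↔ ∃ m < c, IsHat (v m) (ℓ m) ∧ ℓ m = t := by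
  simp [hatIndices, and_assoc]

/-- On a hat vector the last coordinate `1` cancels against the single hat index that it meets; on
an unhatted vector other than `e_n` both terms vanish. -/
theorem hatForm_eq_zero (hv : IsStandardSeq v ℓ) (hF : F.SpannedBy v) {c : Fin (r + 1)}
    (hc : ∀ m < c, v m ≠ e (Fin.last r)) :
    ∀ x ∈ F.V c.castSucc, hatForm (hatIndices v ℓ c) x = 0 := by
  have hle : F.V c.castSucc ≤ LinearMap.ker (hatForm (hatIndices v ℓ c)) := by
    refine hF.le_iff.2 fun m hm => ?_
    have hm' : m < c := by simpa using hm
    have hT : ∀ t ∈ hatIndices v ℓ c, t ≠ Fin.last r := by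
      intro t ht
      obtain ⟨m, -, h, rfl⟩ := mem_hatIndices.1 ht
      exact h.1
    rw [LinearMap.mem_ker, hatForm_apply, Finset.sum_congr rfl fun t ht => hv.apply m (hT t ht),
      Finset.sum_ite_eq']
    have hmem : ℓ m ∈ hatIndices v ℓ c ↔ IsHat (v m) (ℓ m) := by
      rw [mem_hatIndices]
      constructor
      · rintro ⟨m', -, h, h'⟩
        rwa [hv.injective hF h'] at h
      · exact fun h => ⟨m, hm', h, rfl⟩
    rcases hv.vec m with h | h
    · have h1 : ℓ m ≠ Fin.last r := fun h1 => hc m hm' (hv.eq_last_iff.2 h1)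
      have h2 : ¬ IsHat (v m) (ℓ m) := fun h2 => h2.ne_e _ h
      rw [if_neg (mt hmem.1 h2), h, e_apply, if_neg h1.symm, sub_zero]
    · rw [if_pos (hmem.2 h), h.apply_last, sub_self]
  exact hle

/-! ### Uniqueness of the standard form in a `B_{n-1}`-orbit. -/

/-- The coordinate `ℓ m` of `b v_m` is a nonzero multiple of that of `v_m`. If `ℓ' m` were
different, this coordinate would vanish on `w_m` and on the earlier vectors, which are shared, hence
on a subspace containing `b v_m`. -/
theorem index_eq_of_smul_eq (hv : IsStandardSeq v ℓ) (hF : F.SpannedBy v)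
    (hw : IsStandardSeq w ℓ') {b : GLn r} (hb : b ∈ Bsub r) (hG : (b • F).SpannedBy w)
    {m : Fin (r + 1)} (hlt : ∀ k < m, v k = w k) (hm : v m ≠ e (Fin.last r)) : ℓ m = ℓ' m := by
  have hl : ℓ m ≠ Fin.last r := fun h => hm (hv.eq_last_iff.2 h)
  have hcoord : b.1.mulVec (v m) (ℓ m) ≠ 0 := by
    rw [mulVec_apply_of_mem_Bsub hb hl fun l h1 h2 => by rw [hv.apply m h2, if_neg h1.ne'],
      hv.apply m hl, if_pos rfl, mul_one]
    exact apply_self_ne_zero_of_mem_Bsub hb _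
  by_contra hne
  have hle : (b • F).V m.succ ≤ LinearMap.ker (LinearMap.proj (ℓ m) : Vec r →ₗ[ℂ] ℂ) := by
    refine hG.le_iff.2 fun k hk => ?_
    have hk' : k ≤ m := Fin.castSucc_lt_succ_iff.1 hk
    refine (hw.apply k hl).trans (if_neg ?_)
    rcases hk'.lt_or_eq with h | rfl
    · intro heq
      have h1 := hw.apply k hl
      rw [← hlt k h, hv.apply k hl, if_pos heq] at h1
      split_ifs at h1 with h2
      · exact h.ne (hv.injective hF h2).symm
      · exact zero_ne_one h1
    · exact hne
  exact hcoord (hle (mulVec_mem_smul_V b (hF.mem_succ m)))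

/-- If `b • G = F`, then `x = b e_{ℓ m}` is killed by the form attached to the hats of `F` up to
position `m`. But `x_n = 0`, and earlier hats have larger indices, where `x` vanishes, so the form
takes the value `-b_{ℓ m, ℓ m} ≠ 0`. -/
theorem not_isHat_of_smul_eq (hv : IsStandardSeq v ℓ) (hF : F.SpannedBy v) {b : GLn r}
    (hb : b ∈ Bsub r) {m : Fin (r + 1)} (h : IsHat (v m) (ℓ m))
    (hG : e (ℓ m) ∈ G.V m.succ) : b • G ≠ F := by
  rintro rfl
  set x := b.1.mulVec (e (ℓ m)) with hx
  have hxF : x ∈ (b • G).V m.succ := mulVec_mem_smul_V b hG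
  have hlast : ∀ k ≤ m, v k ≠ e (Fin.last r) := by
    intro k hk hk'
    rcases hk.lt_or_eq with hk | rfl
    · exact h.ne_e _ (hv.after_last k m hk' hk)
    · exact h.ne_e _ hk'
  -- Since `e_n` comes after the hat at `m`, there is a next position `c`, and the hat at `m` itself
  -- is counted among those before `c`.
  obtain ⟨c, hc⟩ : ∃ c : Fin (r + 1), m.succ = c.castSucc := by
    obtain ⟨j, hj⟩ := hv.exists_last
    have : m < j := by
      by_contra! h
      exact hlast j h hj
    exact ⟨⟨m + 1, by omega⟩, by simp [Fin.ext_iff]⟩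
  have hmc : ∀ k, k < c ↔ k ≤ m := by
    intro k
    rw [Fin.ext_iff, Fin.val_succ, Fin.val_castSucc] at hc
    rw [Fin.lt_def, Fin.le_def, ← hc, Nat.lt_succ_iff]
  rw [hc] at hxF
  have h0 := hv.hatForm_eq_zero hF (c := c) (fun k hk => hlast k ((hmc k).1 hk)) x hxF
  have hxl : ∀ l, ℓ m ≤ l → l ≠ Fin.last r → x l = b.1 l l * (if l = ℓ m then 1 else 0) := by
    intro l hl hl'
    rw [hx, mulVec_apply_of_mem_Bsub hb hl' fun k hk _ => ?_, e_apply]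
    rw [e_apply, if_neg (hl.trans_lt hk).ne']
  rw [hatForm_apply, hx, mulVec_apply_last_of_mem_K hb.1, ← hx, e_apply, if_neg h.1.symm,
    Finset.sum_eq_single (ℓ m), hxl _ le_rfl h.1, if_pos rfl] at h0
  · exact apply_self_ne_zero_of_mem_Bsub hb (ℓ m) (by simpa using h0)
  · intro t ht hne
    obtain ⟨k, hk, hk', rfl⟩ := mem_hatIndices.1 ht
    have hkm : k < m := lt_of_le_of_ne ((hmc k).1 hk) fun h => hne (h ▸ rfl)
    rw [hxl _ (hv.hat_anti k m hkm hk' h).le hk'.1, if_neg hne, mul_zero]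
  · intro hnot
    exact absurd (mem_hatIndices.2 ⟨m, (hmc m).2 le_rfl, h, rfl⟩) hnot

theorem e_last_mem_smul_iff {b : GLn r} (hb : b ∈ K r) {k : Fin (r + 2)} :
    e (Fin.last r) ∈ (b • F).V k ↔ e (Fin.last r) ∈ F.V k := by
  have key : ∀ (F : CompleteFlag r) (b : GLn r), b ∈ K r → e (Fin.last r) ∈ F.V k →
      e (Fin.last r) ∈ (b • F).V k := by
    intro F b hb h
    have := mulVec_mem_smul_V b h
    rwa [mulVec_e_last_of_mem_K hb] at this
  refine ⟨fun h => ?_, key F b hb⟩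
  have := key _ _ ((K r).inv_mem hb) h
  rwa [inv_smul_smul] at this

/-- A `B_{n-1}`-orbit contains at most one flag in standard form. -/
theorem eq_of_smul_eq (hv : IsStandardSeq v ℓ) (hF : F.SpannedBy v) (hw : IsStandardSeq w ℓ')
    (hG : G.SpannedBy w) {b : GLn r} (hb : b ∈ Bsub r) (hbF : b • F = G) : v = w := by
  subst hbF
  funext m
  induction m using WellFoundedLT.induction with
  | _ m ih =>
    have hlast : v m = e (Fin.last r) ↔ w m = e (Fin.last r) := by
      rw [hv.mem_V_iff hF, hw.mem_V_iff hG, e_last_mem_smul_iff hb.1, e_last_mem_smul_iff hb.1]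
    by_cases hm : v m = e (Fin.last r)
    · rw [hm, hlast.1 hm]
    have hidx := hv.index_eq_of_smul_eq hF hw hb hG ih hm
    rcases hv.vec m with h1 | h1 <;> rcases hw.vec m with h2 | h2
    · rw [h1, h2, hidx]
    · exact absurd rfl (hw.not_isHat_of_smul_eq hG hb h2 (by
        rw [← hidx, ← h1]
        exact hF.mem_succ m))
    · exact absurd (inv_smul_smul b F) (hv.not_isHat_of_smul_eq hF ((Bsub r).inv_mem hb) h1 (by
        rw [hidx, ← h2]
        exact hG.mem_succ m))
    · rw [h1.2, h2.2, hidx]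

theorem stdMonoidAct {a : Fin r} (hw : IsStandardSeq w ℓ') (hG : G.SpannedBy w)
    (h : MonoidAct (Bsub r) a (orb (Bsub r) F) (orb (Bsub r) G)) : StdMonoidAct a F w := by
  refine ⟨⟨ℓ', hw⟩, G, hG, _, h, fun F'' => ⟨?_, ?_⟩⟩
  · rintro ⟨⟨v, ℓ, hv, hF⟩, hmem⟩
    obtain ⟨b, hb, h⟩ := mem_orb.1 (mem_orb_comm.1 hmem)
    rw [hv.eq_of_smul_eq hF hw hG hb h] at hF
    exact hF.unique hG
  · rintro rfl
    exact ⟨⟨w, ℓ', hw, hG⟩, self_mem_orb _⟩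

end IsStandardSeq

/-! ### The `K`-orbits -/

/-- `K` preserves both the last coordinate and `e_n`. Thus `i` is recovered as the step where the
last coordinate first becomes nonzero, and `j` as the step where `e_n` enters. -/
theorem apply_last_of_mem_QK {i j : Fin (r + 1)} {F : CompleteFlag r} (hij : i ≤ j)
    (h : F ∈ QK i j) : (∀ x ∈ F.V i.castSucc, x (Fin.last r) = 0) ∧
      (∃ x ∈ F.V i.succ, x (Fin.last r) ≠ 0) ∧
      e (Fin.last r) ∈ F.V j.succ ∧ e (Fin.last r) ∉ F.V j.castSucc := by
  obtain ⟨F₀, hF₀, hF⟩ := h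
  obtain ⟨g, hg, rfl⟩ := mem_orb.1 hF
  rw [IsStandardSeq.e_last_mem_smul_iff hg, IsStandardSeq.e_last_mem_smul_iff hg]
  have hj : refVec i j j = (e (Fin.last r) : Vec r) := by
    rw [refVec, if_neg hij.not_gt, if_pos rfl]
  refine ⟨?_, ?_, hj ▸ hF₀.mem_succ j, hj ▸ hF₀.notMem j⟩
  · rintro _ ⟨x, hx, rfl⟩
    refine (mulVec_apply_last_of_mem_K hg x).trans ?_
    have hle : F₀.V i.castSucc ≤ LinearMap.ker (LinearMap.proj (Fin.last r) : Vec r →ₗ[ℂ] ℂ) := by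
      refine hF₀.le_iff.2 fun m hm => ?_
      have hm' : m < i := by simpa using hm
      have hml : Fin.last r ≠ m := (hm'.trans_le (Fin.le_last i)).ne'
      rw [refVec, if_pos hm', LinearMap.mem_ker, LinearMap.proj_apply, e_apply, if_neg hml]
    exact hle hx
  · refine ⟨_, mulVec_mem_smul_V g (hF₀.mem_succ i), ?_⟩
    rw [mulVec_apply_last_of_mem_K hg]
    rcases hij.eq_or_lt with rfl | hlt
    · rw [hj, e_apply, if_pos rfl]
      exact one_ne_zero
    · have hne : Fin.last r ≠ (⟨(j : ℕ) - 1, by omega⟩ : Fin (r + 1)) := by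
        rw [Ne, Fin.ext_iff, Fin.val_last]
        simp only
        have := Fin.lt_def.1 hlt
        omega
      have hi : refVec i j i = (eHat ⟨(j : ℕ) - 1, by omega⟩ : Vec r) := by
        simp [refVec, hlt.ne]
      rw [hi, eHat_apply, if_neg hne, if_pos rfl, zero_add]
      exact one_ne_zero

namespace IsStandardSeq

variable {v : Fin (r + 1) → Vec r} {ℓ : Fin (r + 1) → Fin (r + 1)} {F : CompleteFlag r}
  {i j : Fin (r + 1)}

theorem eq_last_of_mem_QK (hv : IsStandardSeq v ℓ) (hF : F.SpannedBy v) (hij : i ≤ j)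
    (h : F ∈ QK i j) : v j = e (Fin.last r) :=
  (hv.mem_V_iff hF).2 (apply_last_of_mem_QK hij h).2.2

theorem eq_e_of_mem_QK (hv : IsStandardSeq v ℓ) (hF : F.SpannedBy v) (hij : i ≤ j)
    (h : F ∈ QK i j) {m : Fin (r + 1)} (hm : m < i) : v m = e (ℓ m) :=
  (hv.vec m).resolve_right fun h1 => one_ne_zero (h1.apply_last.symm.trans
    ((apply_last_of_mem_QK hij h).1 _ (hF.mem (by simpa using hm))))

theorem isHat_of_mem_QK (hv : IsStandardSeq v ℓ) (hF : F.SpannedBy v) (hij : i < j)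
    (h : F ∈ QK i j) : IsHat (v i) (ℓ i) := by
  refine (hv.vec i).resolve_left fun h1 => ?_
  obtain ⟨x, hx, hx'⟩ := (apply_last_of_mem_QK hij.le h).2.1
  have hj := hv.eq_last_of_mem_QK hF hij.le h
  have hle : F.V i.succ ≤ LinearMap.ker (LinearMap.proj (Fin.last r) : Vec r →ₗ[ℂ] ℂ) := by
    refine hF.le_iff.2 fun m hm => ?_
    have hm' : m ≤ i := Fin.castSucc_lt_succ_iff.1 hm
    have hm2 : v m = e (ℓ m) := by
      rcases hm'.lt_or_eq with hm' | rfl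
      · exact hv.eq_e_of_mem_QK hF hij.le h hm'
      · exact h1
    have := hv.index_ne_last hF hj (hm'.trans_lt hij).ne
    rw [hm2, LinearMap.mem_ker, LinearMap.proj_apply, e_apply, if_neg this.symm]
  exact hx' (hle hx)

end IsStandardSeq

/-! ### Replacing two neighbouring vectors in a standard sequence. -/

namespace IsStandardSeq

variable {v w : Fin (r + 1) → Vec r} {ℓ : Fin (r + 1) → Fin (r + 1)} {F G H : CompleteFlag r}
  {a : Fin r}

theorem apply_index_eq_zero (hv : IsStandardSeq v ℓ) (hF : F.SpannedBy v) {c m : Fin (r + 1)}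
    (hcm : c ≤ m) (hm : ℓ m ≠ Fin.last r) : ∀ x ∈ F.V c.castSucc, x (ℓ m) = 0 := by
  have hle : F.V c.castSucc ≤ LinearMap.ker (LinearMap.proj (ℓ m) : Vec r →ₗ[ℂ] ℂ) := by
    refine hF.le_iff.2 fun k hk => (hv.apply k hm).trans (if_neg fun h => ?_)
    exact (lt_of_lt_of_le (Fin.castSucc_lt_castSucc_iff.1 hk) hcm).ne' (hv.injective hF h)
  exact hle

theorem apply_last_eq_zero (hF : F.SpannedBy v) {c : Fin (r + 1)}
    (hc : ∀ m < c, v m = e (ℓ m) ∧ ℓ m ≠ Fin.last r) :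
    ∀ x ∈ F.V c.castSucc, x (Fin.last r) = 0 := by
  have hle : F.V c.castSucc ≤ LinearMap.ker (LinearMap.proj (Fin.last r) : Vec r →ₗ[ℂ] ℂ) := by
    refine hF.le_iff.2 fun k hk => ?_
    obtain ⟨h1, h2⟩ := hc k (Fin.castSucc_lt_castSucc_iff.1 hk)
    rw [LinearMap.mem_ker, LinearMap.proj_apply, h1, e_apply, if_neg h2.symm]
  exact hle

theorem eq_of_isHat (hv : IsStandardSeq v ℓ) {m t : Fin (r + 1)} (h : IsHat (v m) t) :
    ℓ m = t := by
  have h1 := hv.apply m h.1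
  rw [h.apply_of_ne h.1, if_pos rfl] at h1
  split_ifs at h1 with h2
  · exact h2.symm
  · exact absurd h1 one_ne_zero

theorem index_ne_last_of_isHat (hv : IsStandardSeq v ℓ) {m k : Fin (r + 1)} (hk : IsHat (v k) (ℓ k))
    (hm : m ≤ k) : ℓ m ≠ Fin.last r := by
  intro h
  rcases hm.lt_or_eq with hm | rfl
  · exact hk.ne_e _ (hv.after_last m k (hv.eq_last_iff.2 h) hm)
  · exact hk.1 h

theorem of_last {j : Fin (r + 1)} (hj : v j = e (Fin.last r))
    (hvec : ∀ m, v m = e (ℓ m) ∨ IsHat (v m) (ℓ m)) (hbefore : ∀ m < j, v m ≠ e (Fin.last r))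
    (hafter : ∀ m, j < m → v m = e (ℓ m) ∧ v m ≠ e (Fin.last r))
    (hanti : ∀ m k, m < k → k < j → IsHat (v m) (ℓ m) → IsHat (v k) (ℓ k) → ℓ k < ℓ m) :
    IsStandardSeq v ℓ where
  vec := hvec
  exists_last := ⟨j, hj⟩
  after_last m k hm hmk := by
    rcases lt_trichotomy m j with h | rfl | h
    · exact absurd hm (hbefore m h)
    · exact (hafter k hmk).1
    · exact absurd hm (hafter m h).2
  hat_anti m k hmk hm hk := by
    refine hanti m k hmk ?_ hm hk
    by_contra! h
    rcases h.eq_or_lt with rfl | h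
    · exact hk.ne_e _ hj
    · exact hk.ne_e _ (hafter k h).1

/-- The index function of `replaceAt v a x y`. -/
def replaceIndex (ℓ : Fin (r + 1) → Fin (r + 1)) (a : Fin r) (p q : Fin (r + 1)) :
    Fin (r + 1) → Fin (r + 1) :=
  Function.update (Function.update ℓ a.castSucc p) a.succ q

theorem replaceIndex_castSucc (p q : Fin (r + 1)) : replaceIndex ℓ a p q a.castSucc = p := by
  rw [replaceIndex, Function.update_of_ne Fin.castSucc_lt_succ.ne, Function.update_self]

theorem replaceIndex_succ (p q : Fin (r + 1)) : replaceIndex ℓ a p q a.succ = q := by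
  rw [replaceIndex, Function.update_self]

theorem replaceIndex_of_ne (p q : Fin (r + 1)) {m : Fin (r + 1)} (h : m ≠ a.castSucc)
    (h' : m ≠ a.succ) : replaceIndex ℓ a p q m = ℓ m := by
  rw [replaceIndex, Function.update_of_ne h', Function.update_of_ne h]

theorem vec_replaceAt (hv : IsStandardSeq v ℓ) {x y : Vec r} {p q : Fin (r + 1)}
    (hx : x = e p ∨ IsHat x p) (hy : y = e q ∨ IsHat y q) (m : Fin (r + 1)) :
    replaceAt v a x y m = e (replaceIndex ℓ a p q m) ∨
      IsHat (replaceAt v a x y m) (replaceIndex ℓ a p q m) := by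
  refine forall_replaceAt (p := fun m w => w = e (replaceIndex ℓ a p q m) ∨
    IsHat w (replaceIndex ℓ a p q m)) ?_ ?_ (fun m h1 h2 => ?_) m
  · rwa [replaceIndex_castSucc]
  · rwa [replaceIndex_succ]
  · rw [replaceIndex_of_ne _ _ h1 h2]
    exact hv.vec m

theorem lt_succ_cases {m : Fin (r + 1)} (h : m < a.succ) : m = a.castSucc ∨ m < a.castSucc := by
  simp only [Fin.lt_def, Fin.ext_iff, Fin.val_succ, Fin.val_castSucc] at h ⊢
  omega

theorem replaceAt_of_lt (v : Fin (r + 1) → Vec r) (x y : Vec r) {m : Fin (r + 1)}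
    (h : m < a.castSucc) : replaceAt v a x y m = v m :=
  replaceAt_of_ne _ _ _ _ h.ne (h.trans Fin.castSucc_lt_succ).ne

theorem replaceAt_of_gt (v : Fin (r + 1) → Vec r) (x y : Vec r) {m : Fin (r + 1)}
    (h : a.succ < m) : replaceAt v a x y m = v m :=
  replaceAt_of_ne _ _ _ _ (Fin.castSucc_lt_succ.trans h).ne' h.ne'

theorem replaceIndex_of_lt (p q : Fin (r + 1)) {m : Fin (r + 1)} (h : m < a.castSucc) :
    replaceIndex ℓ a p q m = ℓ m :=
  replaceIndex_of_ne _ _ h.ne (h.trans Fin.castSucc_lt_succ).ne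

theorem replaceIndex_of_gt (p q : Fin (r + 1)) {m : Fin (r + 1)} (h : a.succ < m) :
    replaceIndex ℓ a p q m = ℓ m :=
  replaceIndex_of_ne _ _ (Fin.castSucc_lt_succ.trans h).ne' h.ne'

/-- Covers all the results in which `e_n` ends up at `a.succ`. -/
theorem replaceAt_last (hv : IsStandardSeq v ℓ) {x : Vec r} {p : Fin (r + 1)}
    (hx : x = e p ∨ IsHat x p) (hx' : x ≠ e (Fin.last r))
    (hbefore : ∀ m < a.castSucc, v m ≠ e (Fin.last r))
    (hafter : ∀ m, a.succ < m → v m = e (ℓ m) ∧ v m ≠ e (Fin.last r))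
    (hanti : IsHat x p → ∀ m < a.castSucc, IsHat (v m) (ℓ m) → p < ℓ m) :
    IsStandardSeq (replaceAt v a x (e (Fin.last r))) (replaceIndex ℓ a p (Fin.last r)) := by
  refine of_last (replaceAt_succ _ _ _ _) (hv.vec_replaceAt hx (Or.inl rfl)) ?_ ?_ ?_
  · intro m hm
    rcases lt_succ_cases hm with rfl | hm
    · rwa [replaceAt_castSucc]
    · rw [replaceAt_of_lt _ _ _ hm]
      exact hbefore m hm
  · intro m hm
    rw [replaceAt_of_gt _ _ _ hm, replaceIndex_of_gt _ _ hm]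
    exact hafter m hm
  · intro m k hmk hk h1 h2
    rcases lt_succ_cases hk with rfl | hk
    · rw [replaceAt_castSucc, replaceIndex_castSucc] at h2
      rw [replaceAt_of_lt _ _ _ hmk, replaceIndex_of_lt _ _ hmk] at h1
      rw [replaceIndex_castSucc, replaceIndex_of_lt _ _ hmk]
      exact hanti h2 m hmk h1
    · have hm := hmk.trans hk
      rw [replaceAt_of_lt _ _ _ hm, replaceIndex_of_lt _ _ hm] at h1
      rw [replaceAt_of_lt _ _ _ hk, replaceIndex_of_lt _ _ hk] at h2
      rw [replaceIndex_of_lt _ _ hm, replaceIndex_of_lt _ _ hk]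
      exact hv.hat_anti m k hmk h1 h2

/-- Covers both results for `α_{i-1}` in Case I: the new vector `y` is either unhatted or the old
hat. The inequality `hp` keeps the later hat indices below `p`. -/
theorem replaceAt_hat (hv : IsStandardSeq v ℓ) (hF : F.SpannedBy v) {x y : Vec r}
    {p q : Fin (r + 1)} (hx : IsHat x p) (hy : y = e q ∨ IsHat y q) (hy' : q ≠ Fin.last r)
    (hbefore : ∀ m < a.castSucc, v m = e (ℓ m)) (hsucc : IsHat (v a.succ) (ℓ a.succ))
    (hp : ℓ a.succ ≤ p) (hq : IsHat y q → q = ℓ a.succ ∧ ℓ a.succ < p) :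
    IsStandardSeq (replaceAt v a x y) (replaceIndex ℓ a p q) := by
  obtain ⟨j, hj⟩ := hv.exists_last
  have haj : a.succ < j := by
    by_contra! h
    exact hv.index_ne_last_of_isHat hsucc h (hv.index_of_eq_last hj)
  have hne : ∀ m, m ≠ j → v m ≠ e (Fin.last r) := fun m hm h =>
    hv.index_ne_last hF hj hm (hv.index_of_eq_last h)
  have hyl : y ≠ e (Fin.last r) := by
    rcases hy with rfl | hy
    · exact fun h => hy' (e_injective h)
    · exact hy.ne_e _
  have hle : ∀ m < a.castSucc, ¬ IsHat (v m) (ℓ m) := fun m hm h => h.ne_e _ (hbefore m hm)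
  refine of_last (j := j) ?_ (hv.vec_replaceAt (Or.inr hx) hy) ?_ ?_ ?_
  · rwa [replaceAt_of_gt _ _ _ haj]
  · intro m hm
    refine forall_replaceAt (p := fun m w => m < j → w ≠ e (Fin.last r))
      (fun _ => hx.ne_e _) (fun _ => hyl) (fun m _ _ hm => hne m hm.ne) m hm
  · intro m hm
    have hm' := haj.trans hm
    rw [replaceAt_of_gt _ _ _ hm', replaceIndex_of_gt _ _ hm']
    exact ⟨hv.after_last j m hj hm, hne m hm.ne'⟩
  · intro m k hmk hk h1 h2
    rcases lt_trichotomy m a.castSucc with hm | rfl | hm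
    · rw [replaceAt_of_lt _ _ _ hm, replaceIndex_of_lt _ _ hm] at h1
      exact absurd h1 (hle m hm)
    · rw [replaceIndex_castSucc]
      rcases (Fin.castSucc_lt_iff_succ_le.1 hmk : a.succ ≤ k).eq_or_lt with rfl | hk'
      · rw [replaceAt_succ, replaceIndex_succ] at h2
        rw [replaceIndex_succ, (hq h2).1]
        exact (hq h2).2
      · rw [replaceAt_of_gt _ _ _ hk', replaceIndex_of_gt _ _ hk'] at h2
        rw [replaceIndex_of_gt _ _ hk']
        exact (hv.hat_anti _ _ hk' hsucc h2).trans_le hp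
    · have hk' : a.succ < k := lt_of_le_of_lt (Fin.castSucc_lt_iff_succ_le.1 hm) hmk
      rw [replaceAt_of_gt _ _ _ hk', replaceIndex_of_gt _ _ hk'] at h2
      rw [replaceIndex_of_gt _ _ hk']
      rcases (Fin.castSucc_lt_iff_succ_le.1 hm : a.succ ≤ m).eq_or_lt with rfl | hm'
      · rw [replaceAt_succ, replaceIndex_succ] at h1
        rw [replaceIndex_succ, (hq h1).1]
        exact hv.hat_anti _ _ hk' hsucc h2
      · rw [replaceAt_of_gt _ _ _ hm', replaceIndex_of_gt _ _ hm'] at h1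
        rw [replaceIndex_of_gt _ _ hm']
        exact hv.hat_anti _ _ hmk h1 h2

/-- Two points of the fibre that are exchanged by an elementary matrix of `B_{n-1}`. -/
theorem mem_orb_of_elementary (hv : IsStandardSeq v ℓ) (hF : F.SpannedBy v) {p : Fin (r + 1)}
    (hp : p ≠ Fin.last r) (hpa : p = ℓ a.castSucc ∨ p = ℓ a.succ) {z : Vec r}
    (hz : ∀ l, p < l → z l = 0) (hzp : 1 + z p ≠ 0) {u₁ u₂ w₁ w₂ : Vec r}
    (hH : H.SpannedBy (replaceAt v a u₁ u₂)) (hG : G.SpannedBy (replaceAt v a w₁ w₂))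
    (h₁ : u₁ + u₁ p • z ∈ G.V a.castSucc.succ) (h₂ : u₂ + u₂ p • z ∈ G.V a.succ.succ) :
    H ∈ orb (Bsub r) G := by
  obtain ⟨b, hb, hbx⟩ := exists_mem_Bsub p hp z hz hzp
  refine mem_orb_comm.2 (mem_orb.2 ⟨b, hb, smul_eq_of_mem hH fun m => ?_⟩)
  simp only [hbx]
  refine forall_replaceAt (p := fun m w => w + w p • z ∈ G.V m.succ) h₁ h₂ (fun m h1 h2 => ?_) m
  have hne : p ≠ ℓ m := by
    rintro rfl
    rcases hpa with h | h
    · exact h1 (hv.injective hF h)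
    · exact h2 (hv.injective hF h)
  rw [hv.apply m hp, if_neg hne, zero_smul, add_zero]
  have := hG.mem_succ m
  rwa [replaceAt_of_ne _ _ _ _ h1 h2] at this

/-- Serves to show that a proposed sequence does span a flag, by transporting one that is known to.
-/
theorem exists_spannedBy_of_elementary (hv : IsStandardSeq v ℓ) (hF : F.SpannedBy v)
    {p : Fin (r + 1)} (hp : p ≠ Fin.last r) (hpa : p = ℓ a.castSucc ∨ p = ℓ a.succ) {z : Vec r}
    (hz : ∀ l, p < l → z l = 0) (hzp : 1 + z p ≠ 0) {u₁ u₂ w₁ w₂ : Vec r}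
    (hH : H.SpannedBy (replaceAt v a u₁ u₂)) (h₁ : u₁ + u₁ p • z = w₁)
    (h₂ : u₂ + u₂ p • z = w₂) : ∃ G : CompleteFlag r, G.SpannedBy (replaceAt v a w₁ w₂) := by
  obtain ⟨b, hb, hbx⟩ := exists_mem_Bsub p hp z hz hzp
  refine ⟨b • H, ?_⟩
  convert hH.smul b using 1
  funext m
  simp only [hbx]
  refine (forall_replaceAt (p := fun m w => w + w p • z = replaceAt v a w₁ w₂ m) ?_ ?_
    (fun m h1 h2 => ?_) m).symm
  · rw [h₁, replaceAt_castSucc]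
  · rw [h₂, replaceAt_succ]
  · have hne : p ≠ ℓ m := by
      rintro rfl
      rcases hpa with h | h
      · exact h1 (hv.injective hF h)
      · exact h2 (hv.injective hF h)
    rw [hv.apply m hp, if_neg hne, zero_smul, add_zero, replaceAt_of_ne _ _ _ _ h1 h2]

/-! ### The five types of neighbouring vectors -/

theorem complexStable_of_e_hat (hv : IsStandardSeq v ℓ) (hF : F.SpannedBy v)
    (hbefore : ∀ m ≤ a.castSucc, v m = e (ℓ m)) (hs : IsHat (v a.succ) (ℓ a.succ))
    (hlt : ℓ a.castSucc < ℓ a.succ) :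
    IsComplexStable (Bsub r) a (orb (Bsub r) F) ∧
      StdMonoidAct a F (replaceAt v a (eHat (ℓ a.succ)) (e (ℓ a.castSucc))) := by
  have hc := hbefore _ le_rfl
  have hnl : ∀ m ≤ a.succ, ℓ m ≠ Fin.last r := fun m hm => hv.index_ne_last_of_isHat hs hm
  have hcl := hnl a.castSucc Fin.castSucc_lt_succ.le
  obtain ⟨g, -, hF'⟩ := exists_flip hF a
  have hw : IsStandardSeq (replaceAt v a (v a.succ) (v a.castSucc)) _ :=
    hv.replaceAt_hat hF hs (Or.inl hc) hcl (fun m hm => hbefore m hm.le) hs le_rfl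
      fun h => absurd hc (h.ne_e _)
  have hcl0 : v a.castSucc (Fin.last r) = 0 := by rw [hc, e_apply, if_neg hcl.symm]
  obtain ⟨h1, h2⟩ := isComplexStable_and_monoidAct (M := Bsub r) hF hF'
    (Z := coordKer {Fin.last r}) (stable_coordKer fun l hl hl' => absurd hl hl')
    (by rintro l rfl; exact hcl0)
    (LinearMap.proj (Fin.last r))
    (apply_last_eq_zero hF fun m hm =>
      ⟨hbefore m hm.le, hnl m (hm.trans Fin.castSucc_lt_succ).le⟩)
    (fun u hu => hu _ rfl)
    (by rw [LinearMap.proj_apply, hs.apply_last]; exact one_ne_zero) fun t H ht hH => by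
      have g1 := hF'.mem_succ a.castSucc
      have g2 := hF'.mem_succ a.succ
      rw [replaceAt_castSucc] at g1
      rw [replaceAt_succ] at g2
      -- With `x = e_c` and `y = ê_s`, the vector `x + t y` has `s`-th coordinate `t`, so this `z`
      -- cancels `x` and leaves `t y`. It is allowed because `c < s`.
      refine hv.mem_orb_of_elementary hF hs.1 (Or.inr rfl) (z := -(t⁻¹ • v a.castSucc)) ?_ ?_
        hH hF' ?_ ?_
      · intro l hl
        rw [hc, Pi.neg_apply, Pi.smul_apply, e_apply, if_neg (hlt.trans hl).ne', smul_zero,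
          neg_zero]
      · rw [hc, Pi.neg_apply, Pi.smul_apply, e_apply, if_neg hlt.ne', smul_zero,
          neg_zero, add_zero]
        exact one_ne_zero
      · rw [Pi.add_apply, Pi.smul_apply, hv.apply _ hs.1, hv.apply _ hs.1, if_pos rfl,
          if_neg hlt.ne', zero_add, smul_eq_mul, mul_one, smul_neg, smul_smul, mul_inv_cancel₀ ht,
          one_smul]
        convert Submodule.smul_mem _ t g1 using 1
        abel
      · exact Submodule.add_mem _ (CompleteFlag.mono _ (Fin.castSucc_le_succ a.succ) g1)
          (Submodule.smul_mem _ _ (Submodule.neg_mem _ (Submodule.smul_mem _ _ g2)))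
  refine ⟨h1, ?_⟩
  have := stdMonoidAct hw hF' h2
  rwa [hs.2, hc] at this

theorem stable_coordKer_singleton_last :
    Stable (Bsub r) (coordKer ({Fin.last r} : Set (Fin (r + 1)))) :=
  stable_coordKer fun _ hl hl' => absurd hl hl'

theorem stable_coordKer_ne_last :
    Stable (Bsub r) (coordKer {l : Fin (r + 1) | l ≠ Fin.last r}) :=
  stable_coordKer fun _ _ _ _ _ h => h

theorem noncompact_of_e_hat (hv : IsStandardSeq v ℓ) (hF : F.SpannedBy v)
    (hbefore : ∀ m ≤ a.castSucc, v m = e (ℓ m)) (hs : IsHat (v a.succ) (ℓ a.succ))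
    (hlt : ℓ a.succ < ℓ a.castSucc) :
    IsNoncompact (Bsub r) a (orb (Bsub r) F) ∧
      StdMonoidAct a F (replaceAt v a (eHat (ℓ a.castSucc)) (eHat (ℓ a.succ))) := by
  have hc := hbefore _ le_rfl
  have hnl : ∀ m ≤ a.succ, ℓ m ≠ Fin.last r := fun m hm => hv.index_ne_last_of_isHat hs hm
  have hcl := hnl a.castSucc Fin.castSucc_lt_succ.le
  have hxc : v a.castSucc (ℓ a.castSucc) = 1 := by rw [hv.apply _ hcl, if_pos rfl]
  have hyc : v a.succ (ℓ a.castSucc) = 0 := by rw [hv.apply _ hcl, if_neg hlt.ne']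
  obtain ⟨γ, -, -, -, hγ⟩ := exists_shear hF a
  obtain ⟨G, hG⟩ := hv.exists_spannedBy_of_elementary hF hcl (Or.inl rfl)
    (z := -e (ℓ a.succ)) (w₁ := eHat (ℓ a.castSucc)) (w₂ := eHat (ℓ a.succ))
    (fun l hl => by rw [Pi.neg_apply, e_apply, if_neg (hlt.trans hl).ne', neg_zero])
    (by rw [Pi.neg_apply, e_apply, if_neg hlt.ne', neg_zero, add_zero]; exact one_ne_zero) (hγ 1)
    (by
      rw [Pi.add_apply, Pi.smul_apply, hxc, hyc, smul_zero, add_zero, one_smul, one_smul, hc,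
        hs.2, eHat, eHat]
      abel)
    (by rw [hyc, zero_smul, add_zero, hs.2])
  have hw : IsStandardSeq (replaceAt v a (eHat (ℓ a.castSucc)) (eHat (ℓ a.succ))) _ :=
    hv.replaceAt_hat hF ⟨hcl, rfl⟩ (Or.inr ⟨hs.1, rfl⟩) hs.1 (fun m hm => hbefore m hm.le) hs
      hlt.le fun _ => ⟨rfl, hlt⟩
  obtain ⟨h1, h2⟩ := isNoncompact_and_monoidAct (M := Bsub r) (G := G) hF
    (Z₁ := coordKer {Fin.last r}) (Z₂ := coordKer {l | ℓ a.castSucc ≤ l ∧ l ≠ Fin.last r})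
    stable_coordKer_singleton_last
    (stable_coordKer fun l hl _ m hm hm' => ⟨hl.1.trans hm, hm'⟩)
    (by rintro l rfl; rw [hc, e_apply, if_neg hcl.symm])
    (fun l hl => by rw [hv.apply _ hl.2, if_neg (hlt.trans_le hl.1).ne'])
    (LinearMap.proj (Fin.last r)) (LinearMap.proj (ℓ a.castSucc))
    (apply_last_eq_zero hF fun m hm =>
      ⟨hbefore m hm.le, hnl m (hm.trans Fin.castSucc_lt_succ).le⟩)
    (hv.apply_index_eq_zero hF le_rfl hcl)
    (fun u hu => hu _ rfl) (fun u hu => hu _ ⟨le_rfl, hcl⟩)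
    (by rw [LinearMap.proj_apply, hs.apply_last]; exact one_ne_zero)
    (by rw [LinearMap.proj_apply, hxc]; exact one_ne_zero) fun t H ht hH => by
      have g1 := hG.mem_succ a.castSucc
      have g2 := hG.mem_succ a.succ
      rw [replaceAt_castSucc] at g1
      rw [replaceAt_succ] at g2
      -- With `c = ℓ a.castSucc` and `s = ℓ a.succ`, this turns `e_c + t ê_s` into `t ê_c` and fixes
      -- `ê_s`.
      refine hv.mem_orb_of_elementary hF hcl (Or.inl rfl)
        (z := (t - 1) • e (ℓ a.castSucc) - t • e (ℓ a.succ)) ?_ ?_ hH hG ?_ ?_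
      · intro l hl
        simp [e_apply, hl.ne', (hlt.trans hl).ne']
      · simpa [e_apply, hlt.ne'] using ht
      · rw [Pi.add_apply, Pi.smul_apply, hxc, hyc, smul_zero, add_zero, one_smul]
        convert Submodule.smul_mem _ t g1 using 1
        rw [hc, hs.2, eHat, eHat]
        module
      · rwa [hyc, zero_smul, add_zero, hs.2]
  exact ⟨h1, stdMonoidAct hw hG h2⟩

theorem complexStable_of_last_e (hv : IsStandardSeq v ℓ) (hF : F.SpannedBy v)
    (hc : v a.castSucc = e (Fin.last r)) {k : Fin (r + 1)}
    (hk : k ∈ hatIndices v ℓ a.castSucc) (hlt : k < ℓ a.succ) :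
    IsComplexStable (Bsub r) a (orb (Bsub r) F) ∧
      StdMonoidAct a F (replaceAt v a (e (ℓ a.succ)) (e (Fin.last r))) := by
  have hs := hv.after_last _ _ hc Fin.castSucc_lt_succ
  have hnl : ∀ m, m ≠ a.castSucc → ℓ m ≠ Fin.last r := fun m hm => hv.index_ne_last hF hc hm
  have hne : ∀ m, m ≠ a.castSucc → v m ≠ e (Fin.last r) := fun m hm =>
    mt hv.eq_last_iff.1 (hnl m hm)
  have hsl := hnl a.succ Fin.castSucc_lt_succ.ne'
  have hys : v a.succ (ℓ a.succ) = 1 := by rw [hv.apply _ hsl, if_pos rfl]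
  have hxs : v a.castSucc (ℓ a.succ) = 0 := by rw [hc, e_apply, if_neg hsl]
  obtain ⟨g, -, hF'⟩ := exists_flip hF a
  have hw := hv.replaceAt_last (a := a) (Or.inl hs) (hne _ Fin.castSucc_lt_succ.ne')
    (fun m hm => hne m hm.ne) (fun m hm => ⟨hv.after_last _ _ hc (Fin.castSucc_lt_succ.trans hm),
      hne m (Fin.castSucc_lt_succ.trans hm).ne'⟩) fun h => absurd hs (h.ne_e _)
  rw [← hc] at hw
  obtain ⟨m, hm, hmh, rfl⟩ := mem_hatIndices.1 hk
  obtain ⟨h1, h2⟩ := isComplexStable_and_monoidAct (M := Bsub r) hF hF'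
    stable_coordKer_ne_last (fun l hl => by rw [hc, e_apply, if_neg hl])
    (LinearMap.proj (ℓ a.succ)) (hv.apply_index_eq_zero hF Fin.castSucc_lt_succ.le hsl)
    (fun u hu => hu _ hsl)
    (by rw [LinearMap.proj_apply, hys]; exact one_ne_zero) fun t H ht hH => by
      have g1 := hF'.mem_succ a.castSucc
      have g2 := hF'.mem_succ a.succ
      have g3 := hF'.mem (Fin.castSucc_lt_succ_iff.2 hm.le)
      rw [replaceAt_castSucc] at g1
      rw [replaceAt_succ, hc] at g2
      rw [replaceAt_of_lt _ _ _ hm, hmh.2] at g3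
      have hmono := CompleteFlag.mono (g • weylFlag (Equiv.swap a.castSucc a.succ))
        (Fin.castSucc_le_succ a.succ)
      -- An earlier hat of smaller index `k` absorbs `e_n`: with `s = ℓ a.succ`, the vector `e_n + t
      -- e_s` becomes `ê_k + t e_s`, and `ê_k` already lies in the earlier subspace.
      refine hv.mem_orb_of_elementary hF hsl (Or.inr rfl) (z := t⁻¹ • e (ℓ m)) ?_ ?_
        hH hF' ?_ ?_
      · intro l hl
        rw [Pi.smul_apply, e_apply, if_neg (hlt.trans hl).ne', smul_zero]
      · rw [Pi.smul_apply, e_apply, if_neg hlt.ne', smul_zero, add_zero]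
        exact one_ne_zero
      · rw [Pi.add_apply, Pi.smul_apply, hxs, hys, zero_add, smul_eq_mul, mul_one, smul_smul,
          mul_inv_cancel₀ ht, one_smul]
        convert Submodule.add_mem _ g3 (Submodule.smul_mem _ t g1) using 1
        rw [hc, eHat]
        abel
      · rw [hys, one_smul]
        refine Submodule.add_mem _ (hmono g1) (Submodule.smul_mem _ _ ?_)
        convert Submodule.sub_mem _ (hmono g3) g2 using 1
        rw [eHat, add_sub_cancel_right]
  refine ⟨h1, ?_⟩
  have := stdMonoidAct hw hF' h2
  rwa [hs, hc] at this

theorem noncompact_of_last_e (hv : IsStandardSeq v ℓ) (hF : F.SpannedBy v)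
    (hc : v a.castSucc = e (Fin.last r)) (hlt : ∀ t ∈ hatIndices v ℓ a.castSucc, ℓ a.succ < t) :
    IsNoncompact (Bsub r) a (orb (Bsub r) F) ∧
      StdMonoidAct a F (replaceAt v a (eHat (ℓ a.succ)) (e (Fin.last r))) := by
  have hs := hv.after_last _ _ hc Fin.castSucc_lt_succ
  have hnl : ∀ m, m ≠ a.castSucc → ℓ m ≠ Fin.last r := fun m hm => hv.index_ne_last hF hc hm
  have hne : ∀ m, m ≠ a.castSucc → v m ≠ e (Fin.last r) := fun m hm =>
    mt hv.eq_last_iff.1 (hnl m hm)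
  have hsl := hnl a.succ Fin.castSucc_lt_succ.ne'
  have hys : v a.succ (ℓ a.succ) = 1 := by rw [hv.apply _ hsl, if_pos rfl]
  have hxs : v a.castSucc (ℓ a.succ) = 0 := by rw [hc, e_apply, if_neg hsl]
  obtain ⟨g, -, hF'⟩ := exists_flip hF a
  obtain ⟨γ, -, -, -, hγ⟩ := exists_shear hF' a
  have hG := hγ 1
  set G := γ 1 • stdFlag r
  rw [replaceAt_castSucc, replaceAt_succ, replaceAt_replaceAt, one_smul, hs, hc] at hG
  have hw := hv.replaceAt_last (a := a) (x := eHat (ℓ a.succ)) (Or.inr ⟨hsl, rfl⟩)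
    (IsHat.ne_e (k := ℓ a.succ) ⟨hsl, rfl⟩ _)
    (fun m hm => hne m hm.ne) (fun m hm => ⟨hv.after_last _ _ hc (Fin.castSucc_lt_succ.trans hm),
      hne m (Fin.castSucc_lt_succ.trans hm).ne'⟩)
    fun _ m hm h => hlt _ (mem_hatIndices.2 ⟨m, hm, h, rfl⟩)
  obtain ⟨h1, h2⟩ := isNoncompact_and_monoidAct (M := Bsub r) (G := G) hF
    (Z₂ := coordKer {l | ℓ a.succ < l})
    stable_coordKer_ne_last (stable_coordKer fun l hl _ m hm _ => lt_of_lt_of_le hl hm)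
    (fun l hl => by rw [hc, e_apply, if_neg hl])
    (fun l hl => by rw [hs, e_apply, if_neg (ne_of_gt hl)])
    -- The last coordinate need not vanish on the earlier hats, hence this corrected form. It kills
    -- `Z₂` because all hat indices exceed `ℓ a.succ`, and equals `1` on `e_n`.
    (LinearMap.proj (ℓ a.succ)) (hatForm (hatIndices v ℓ a.castSucc))
    (hv.apply_index_eq_zero hF Fin.castSucc_lt_succ.le hsl)
    (hv.hatForm_eq_zero hF fun m hm => hne m hm.ne)
    (fun u hu => hu _ hsl)
    (fun u hu => by
      rw [hatForm_apply, hu _ (Fin.lt_last_iff_ne_last.2 hsl),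
        Finset.sum_eq_zero fun t ht => hu t (hlt t ht), sub_zero])
    (by rw [LinearMap.proj_apply, hys]; exact one_ne_zero)
    (by
      rw [hatForm_apply, hc, Finset.sum_eq_zero, e_apply, if_pos rfl, sub_zero]
      · exact one_ne_zero
      · intro t ht
        obtain ⟨m, -, h, rfl⟩ := mem_hatIndices.1 ht
        rw [e_apply, if_neg h.1]) fun t H ht hH => by
      have g1 := hG.mem_succ a.castSucc
      have g2 := hG.mem_succ a.succ
      rw [replaceAt_castSucc] at g1
      rw [replaceAt_succ] at g2
      -- A torus element: it rescales the coordinate `ℓ a.succ` by `t⁻¹`, normalising the parameter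
      -- to `1`.
      refine hv.mem_orb_of_elementary hF hsl (Or.inr rfl)
        (z := (t⁻¹ - 1) • e (ℓ a.succ)) ?_ ?_ hH hG ?_ ?_
      · intro l hl
        simp [e_apply, hl.ne']
      · simpa [e_apply] using ht
      · rw [Pi.add_apply, Pi.smul_apply, hxs, hys, zero_add, smul_eq_mul, mul_one, smul_smul,
          mul_sub, mul_inv_cancel₀ ht]
        convert g1 using 1
        rw [hc, hs]
        module
      · rw [hys, one_smul]
        convert Submodule.smul_mem _ t⁻¹ (Submodule.sub_mem _
          (G.mono (Fin.castSucc_le_succ a.succ) g1) g2) using 1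
        rw [hs]
        module
  exact ⟨h1, stdMonoidAct hw hG h2⟩

theorem noncompact_of_e_last (hv : IsStandardSeq v ℓ) (hF : F.SpannedBy v)
    (hbefore : ∀ m ≤ a.castSucc, v m = e (ℓ m)) (hs : v a.succ = e (Fin.last r)) :
    IsNoncompact (Bsub r) a (orb (Bsub r) F) ∧
      StdMonoidAct a F (replaceAt v a (eHat (ℓ a.castSucc)) (e (Fin.last r))) := by
  have hc := hbefore _ le_rfl
  have hnl : ∀ m, m ≠ a.succ → ℓ m ≠ Fin.last r := fun m hm => hv.index_ne_last hF hs hm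
  have hne : ∀ m, m ≠ a.succ → v m ≠ e (Fin.last r) := fun m hm =>
    mt hv.eq_last_iff.1 (hnl m hm)
  have hcl := hnl a.castSucc Fin.castSucc_lt_succ.ne
  have hxc : v a.castSucc (ℓ a.castSucc) = 1 := by rw [hv.apply _ hcl, if_pos rfl]
  have hyc : v a.succ (ℓ a.castSucc) = 0 := by rw [hs, e_apply, if_neg hcl]
  obtain ⟨γ, -, -, -, hγ⟩ := exists_shear hF a
  have hG := hγ 1
  set G := γ 1 • stdFlag r
  rw [one_smul, hs, hc] at hG
  have hw := hv.replaceAt_last (a := a) (x := eHat (ℓ a.castSucc)) (Or.inr ⟨hcl, rfl⟩)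
    (IsHat.ne_e (k := ℓ a.castSucc) ⟨hcl, rfl⟩ _)
    (fun m hm => hne m (hm.trans Fin.castSucc_lt_succ).ne)
    (fun m hm => ⟨hv.after_last _ _ hs hm, hne m hm.ne'⟩)
    fun _ m hm h => absurd (hbefore m hm.le) (h.ne_e _)
  obtain ⟨h1, h2⟩ := isNoncompact_and_monoidAct (M := Bsub r) (G := G) hF
    (Z₁ := coordKer {l | ℓ a.castSucc < l})
    (stable_coordKer fun l hl _ m hm _ => lt_of_lt_of_le hl hm) stable_coordKer_ne_last
    (fun l hl => by rw [hc, e_apply, if_neg (ne_of_gt hl)])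
    (fun l hl => by rw [hs, e_apply, if_neg hl])
    (LinearMap.proj (Fin.last r)) (LinearMap.proj (ℓ a.castSucc))
    (apply_last_eq_zero hF fun m hm =>
      ⟨hbefore m hm.le, hnl m (hm.trans Fin.castSucc_lt_succ).ne⟩)
    (hv.apply_index_eq_zero hF le_rfl hcl)
    (fun u hu => hu _ (Fin.lt_last_iff_ne_last.2 hcl)) (fun u hu => hu _ hcl)
    (by rw [LinearMap.proj_apply, hs, e_apply, if_pos rfl]; exact one_ne_zero)
    (by rw [LinearMap.proj_apply, hxc]; exact one_ne_zero) fun t H ht hH => by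
      have g1 := hG.mem_succ a.castSucc
      have g2 := hG.mem_succ a.succ
      rw [replaceAt_castSucc] at g1
      rw [replaceAt_succ] at g2
      -- A torus element: rescaling the coordinate `ℓ a.castSucc` by `t` turns `e_c + t e_n`, with
      -- `c` this index, into `t ê_c`.
      refine hv.mem_orb_of_elementary hF hcl (Or.inl rfl)
        (z := (t - 1) • e (ℓ a.castSucc)) ?_ ?_ hH hG ?_ ?_
      · intro l hl
        simp [e_apply, hl.ne']
      · simpa [e_apply] using ht
      · rw [Pi.add_apply, Pi.smul_apply, hxc, hyc, smul_zero, add_zero, one_smul]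
        convert Submodule.smul_mem _ t g1 using 1
        rw [hc, hs]
        module
      · rwa [hyc, zero_smul, add_zero, hs]
  exact ⟨h1, stdMonoidAct hw hG h2⟩

theorem mem_hatIndices_iff_of_mem_QK (hv : IsStandardSeq v ℓ) (hF : F.SpannedBy v)
    {i j t : Fin (r + 1)} (hij : i < j) (h : F ∈ QK i j) :
    t ∈ hatIndices v ℓ j ↔
      t ∈ ({ℓ i} ∪ {t | ∃ m, i < m ∧ m < j ∧ IsHat (v m) t} : Set (Fin (r + 1))) := by
  rw [mem_hatIndices]
  constructor
  · rintro ⟨m, hm, hmh, rfl⟩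
    rcases lt_trichotomy m i with hmi | rfl | hmi
    · exact absurd (hv.eq_e_of_mem_QK hF hij.le h hmi) (hmh.ne_e _)
    · exact Or.inl rfl
    · exact Or.inr ⟨m, hmi, hm, hmh⟩
  · rintro (rfl | ⟨m, -, hm, hmh⟩)
    · exact ⟨i, hij, hv.isHat_of_mem_QK hF hij h, rfl⟩
    · exact ⟨m, hm, by rwa [hv.eq_of_isHat hmh], hv.eq_of_isHat hmh⟩

end IsStandardSeq

end FlagOrbits

/-! ### Assembly of the cases. -/

theorem propositionp (r : ℕ) (F : CompleteFlag r) (v : Fin (r + 1) → Vec r)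
    (ℓ : Fin (r + 1) → Fin (r + 1)) (hv : IsStandardSeq v ℓ) (hF : F.SpannedBy v) :
    -- Case I: the orbit of `F` lies in the non-closed `K`-orbit `Q_{i,j}`, `i < j`
    (∀ i j : Fin (r + 1), i < j → F ∈ QK i j →
      -- the shape of `F`
      ((∀ m, m < i → v m = e (ℓ m)) ∧ IsHat (v i) (ℓ i) ∧
        (∀ m, i < m → m < j → v m = e (ℓ m) ∨ IsHat (v m) (ℓ m)) ∧
        v j = e (Fin.last r) ∧ (∀ m, j < m → v m = e (ℓ m)) ∧
        (∀ m, m ≠ j → ℓ m ≠ Fin.last r)) ∧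
      -- the root `α_{i-1}`
      (∀ a : Fin r, a.succ = i →
        (ℓ a.castSucc < ℓ i →
          IsComplexStable (Bsub r) a (orb (Bsub r) F) ∧
          StdMonoidAct a F (replaceAt v a (eHat (ℓ i)) (e (ℓ a.castSucc)))) ∧
        (ℓ i < ℓ a.castSucc →
          IsNoncompact (Bsub r) a (orb (Bsub r) F) ∧
          StdMonoidAct a F (replaceAt v a (eHat (ℓ a.castSucc)) (eHat (ℓ i))))) ∧
      -- the root `α_j`
      (∀ a : Fin r, a.castSucc = j →
        ∀ k, IsLeast ({ℓ i} ∪ {t | ∃ m, i < m ∧ m < j ∧ IsHat (v m) t}) k →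
        (k < ℓ a.succ →
          IsComplexStable (Bsub r) a (orb (Bsub r) F) ∧
          StdMonoidAct a F (replaceAt v a (e (ℓ a.succ)) (e (Fin.last r)))) ∧
        (ℓ a.succ < k →
          IsNoncompact (Bsub r) a (orb (Bsub r) F) ∧
          StdMonoidAct a F (replaceAt v a (eHat (ℓ a.succ)) (e (Fin.last r)))))) ∧
    -- Case II: the orbit of `F` lies in the closed `K`-orbit `Q_i`
    (∀ i : Fin (r + 1), F ∈ QK i i →
      -- the shape of `F`
      (v i = e (Fin.last r) ∧ ∀ m, m ≠ i → v m = e (ℓ m) ∧ ℓ m ≠ Fin.last r) ∧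
      -- the root `α_{i-1}`
      (∀ a : Fin r, a.succ = i →
        IsNoncompact (Bsub r) a (orb (Bsub r) F) ∧
        StdMonoidAct a F (replaceAt v a (eHat (ℓ a.castSucc)) (e (Fin.last r)))) ∧
      -- the root `α_i`
      (∀ a : Fin r, a.castSucc = i →
        IsNoncompact (Bsub r) a (orb (Bsub r) F) ∧
        StdMonoidAct a F (replaceAt v a (eHat (ℓ a.succ)) (e (Fin.last r))))) := by
  refine ⟨fun i j hij hQ => ?_, fun i hQ => ?_⟩
  · have hj := hv.eq_last_of_mem_QK hF hij.le hQ
    have hi := hv.isHat_of_mem_QK hF hij hQ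
    have hbefore : ∀ m, m < i → v m = e (ℓ m) := fun m => hv.eq_e_of_mem_QK hF hij.le hQ
    refine ⟨⟨hbefore, hi, fun m _ _ => hv.vec m, hj, fun m => hv.after_last j m hj,
      fun m => hv.index_ne_last hF hj⟩, ?_, ?_⟩
    · rintro a rfl
      have hbefore' : ∀ m ≤ a.castSucc, v m = e (ℓ m) := fun m hm =>
        hbefore m (hm.trans_lt Fin.castSucc_lt_succ)
      exact ⟨hv.complexStable_of_e_hat hF hbefore' hi, hv.noncompact_of_e_hat hF hbefore' hi⟩
    · rintro a rfl k ⟨hk, hk'⟩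
      -- The complex case only needs that `k` is some hat index; the non-compact case only needs
      -- that it bounds them all from below.
      refine ⟨hv.complexStable_of_last_e hF hj ((hv.mem_hatIndices_iff_of_mem_QK hF hij hQ).2 hk),
        fun hlt => hv.noncompact_of_last_e hF hj fun t ht => hlt.trans_le
          (hk' ((hv.mem_hatIndices_iff_of_mem_QK hF hij hQ).1 ht))⟩
  · have hi := hv.eq_last_of_mem_QK hF le_rfl hQ
    have hbefore : ∀ m, m < i → v m = e (ℓ m) := fun m => hv.eq_e_of_mem_QK hF le_rfl hQ
    refine ⟨⟨hi, fun m hm => ⟨?_, hv.index_ne_last hF hi hm⟩⟩, ?_, ?_⟩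
    · rcases lt_or_gt_of_ne hm with hm | hm
      · exact hbefore m hm
      · exact hv.after_last i m hi hm
    · rintro a rfl
      exact hv.noncompact_of_e_last hF
        (fun m hm => hbefore m (hm.trans_lt Fin.castSucc_lt_succ)) hi
    · rintro a rfl
      -- No hat precedes `e_n` on the closed orbit, so the condition on hat indices is vacuous.
      refine hv.noncompact_of_last_e hF hi fun t ht => ?_
      obtain ⟨m, hm, h, -⟩ := IsStandardSeq.mem_hatIndices.1 ht
      exact absurd (hbefore m hm) (h.ne_e _)
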